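/- Let $q$ be a prime power and let $m\ge 4$ be even. Let $V=\mathbb F_q^{2m}$ carry the quadratic form $Q(x,y)=\sum_{i=1}^m x_iy_i$ of plus type, and let $V'=\mathbb F_q^{2m-1}$ carry the nondegenerate form $Q'(z,x,y)=z^2+\sum_{i=1}^{m-1}x_iy_i$. For a quadratic form, let $\Omega$ denote the group of all products of an even number of reflections $r_{v_1}\cdots r_{v_k}$ in nonsingular vectors for which the spinor norm $\prod_i Q(v_i)$ is a square in $\mathbb F_q$ (for $q$ odd this is the kernel of the spinor norm in the special orthogonal group; for $q$ even reflections are orthogonal transvections). Put $\Omega^+(2m,q)=\Omega(V,Q)$, $\Omega(2m-1,q)=\Omega(V',Q')$, and let $P\Omega^+(2m,q)$ be the quotient of $\Omega^+(2m,q)$ by its scalar transformations. The exponent $\exp(G)$ of a finite group $G$ is the least common multiple of the orders of its elements. Then $P\Omega^+(2m,q)$ contains a proper subgroup with the same exponent, namely $\Omega(2m-1,q)$. Precisely, for every vector $w\in V$ with $Q(w)\ne 0$, the image $H_w$ in $P\Omega^+(2m,q)$ of the stabilizer of $w$ in $\Omega^+(2m,q)$ is isomorphic to $\Omega(2m-1,q)$,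 is a proper subgroup of $P\Omega^+(2m,q)$, and satisfies $$\exp(H_w)=\exp\bigl(P\Omega^+(2m,q)\bigr).$$ -/

import Mathlib

noncomputable section

namespace FiniteOrthogonal

section General

variable {F V : Type*} [Field F] [AddCommGroup V] [Module F V]

/-- The general orthogonal group `GO(V, Q)`: all linear isometries of the quadratic form `Q`. -/
def GO (Q : QuadraticForm F V) : Subgroup (V ≃ₗ[F] V) where
  carrier := {g | ∀ x, Q (g x) = Q x}
  one_mem' := fun _ => rfl
  mul_mem' := by
    intro g h hg hh x
    exact (hg (h x)).trans (hh x)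
  inv_mem' := by
    intro g hg x
    have h := hg (g⁻¹ x)
    have hx : g (g⁻¹ x) = x := g.apply_symm_apply x
    rw [hx] at h
    exact h.symm

/-- The linear functional `x ↦ B(v, x) / Q(v)`, where `B` is the polar form
`B(x, y) = Q(x + y) - Q(x) - Q(y)`. -/
def coroot (Q : QuadraticForm F V) (v : V) : Module.Dual F V :=
  (Q v)⁻¹ • Q.polarBilin v

theorem coroot_apply_self (Q : QuadraticForm F V) (v : {v : V // Q v ≠ 0}) :
    coroot Q v.1 v.1 = 2 := by
  have h := v.2
  simp only [coroot, LinearMap.smul_apply, QuadraticMap.polarBilin_apply_apply,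
    QuadraticMap.polar_self, smul_eq_mul, nsmul_eq_mul, Nat.cast_ofNat]
  field_simp

/-- The reflection `x ↦ x - (B(v, x) / Q(v)) v` in a nonsingular vector `v`. In characteristic 2
this is the orthogonal transvection attached to `v`. -/
def refl (Q : QuadraticForm F V) (v : {v : V // Q v ≠ 0}) : V ≃ₗ[F] V :=
  Module.reflection (coroot_apply_self Q v)

theorem refl_apply (Q : QuadraticForm F V) (v : {v : V // Q v ≠ 0}) (x : V) :
    refl Q v x = x - ((Q v.1)⁻¹ * QuadraticMap.polar Q v.1 x) • v.1 := by
  simp [refl, Module.reflection_apply, coroot]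

theorem refl_mul_self (Q : QuadraticForm F V) (v : {v : V // Q v ≠ 0}) :
    refl Q v * refl Q v = 1 := by
  ext x
  exact Module.involutive_reflection (coroot_apply_self Q v) x

theorem refl_inv (Q : QuadraticForm F V) (v : {v : V // Q v ≠ 0}) :
    (refl Q v)⁻¹ = refl Q v :=
  inv_eq_of_mul_eq_one_left (refl_mul_self Q v)

theorem refl_mem_GO (Q : QuadraticForm F V) (v : {v : V // Q v ≠ 0}) : refl Q v ∈ GO Q := by
  intro x
  have h := v.2
  rw [refl_apply, sub_eq_add_neg, ← neg_smul, QuadraticMap.map_add Q, QuadraticMap.map_smul,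
    QuadraticMap.polar_smul_right, QuadraticMap.polar_comm Q x v.1]
  simp only [smul_eq_mul]
  field_simp
  ring

/-- The spinor norm of a product of reflections in the vectors of a list is the class of
this scalar modulo nonzero squares. -/
def spinorProd (Q : QuadraticForm F V) (l : List {v : V // Q v ≠ 0}) : F :=
  (l.map fun v => Q v.1).prod

/-- The product of the reflections in the vectors of a list. -/
def reflProd (Q : QuadraticForm F V) (l : List {v : V // Q v ≠ 0}) : V ≃ₗ[F] V :=
  (l.map (refl Q)).prod

/-- The group `Ω(V, Q)`: all products of an even number of reflections whose spinor norm is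
trivial. If `2 ≠ 0` in `F` this says: determinant one and trivial spinor norm (see
`mem_Omega_iff`). Over a finite field of characteristic 2 every scalar is a square, and `Ω` is
the group of all products of an even number of orthogonal transvections (the kernel of the
Dickson invariant in even dimension; the whole group `GO` in odd dimension, where the
reflections in vectors of the radical of `B` are the identity). -/
def Omega (Q : QuadraticForm F V) : Subgroup (V ≃ₗ[F] V) where
  carrier := {g | ∃ l : List {v : V // Q v ≠ 0},
    Even l.length ∧ IsSquare (spinorProd Q l) ∧ reflProd Q l = g}
  one_mem' := ⟨[], by simp, by simp [spinorProd], by simp [reflProd]⟩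
  mul_mem' := by
    rintro _ _ ⟨l, hl, hs, rfl⟩ ⟨l', hl', hs', rfl⟩
    refine ⟨l ++ l', ?_, ?_, ?_⟩
    · rw [List.length_append]
      exact hl.add hl'
    · have h : spinorProd Q (l ++ l') = spinorProd Q l * spinorProd Q l' := by
        simp [spinorProd]
      rw [h]
      exact hs.mul hs'
    · simp [reflProd]
  inv_mem' := by
    rintro _ ⟨l, hl, hs, rfl⟩
    refine ⟨l.reverse, by simpa using hl, ?_, ?_⟩
    · simpa [spinorProd, List.prod_reverse] using hs
    · simp [reflProd, List.prod_inv_reverse, Function.comp_def, refl_inv]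

theorem Omega_le_GO (Q : QuadraticForm F V) : Omega Q ≤ GO Q := by
  rintro _ ⟨l, -, -, rfl⟩
  refine Subgroup.list_prod_mem _ ?_
  intro g hg
  obtain ⟨v, -, rfl⟩ := List.mem_map.1 hg
  exact refl_mem_GO Q v

/-- In characteristic different from two, `Ω` is the intersection of the kernel of the
determinant and the kernel of the spinor norm. -/
theorem mem_Omega_iff [FiniteDimensional F V] (h2 : (2 : F) ≠ 0) (Q : QuadraticForm F V)
    (g : V ≃ₗ[F] V) :
    g ∈ Omega Q ↔ LinearEquiv.det g = 1 ∧
      ∃ l : List {v : V // Q v ≠ 0}, IsSquare (spinorProd Q l) ∧ reflProd Q l = g := by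
  have hd : ∀ v, LinearEquiv.det (refl Q v) = -1 := fun v => by
    apply Units.ext
    have h : (refl Q v : V →ₗ[F] V) = LinearMap.transvection (coroot Q v.1) (-v.1) := by
      ext x
      simp [refl, Module.reflection_apply, LinearMap.transvection.apply, sub_eq_add_neg]
    rw [LinearEquiv.coe_det, h, LinearMap.transvection.det, map_neg, coroot_apply_self]
    norm_num
  have hl : ∀ l, LinearEquiv.det (reflProd Q l) = (-1) ^ l.length := by
    intro l
    induction l with
    | nil => simp [reflProd]
    | cons v l ih =>
      have h : reflProd Q (v :: l) = refl Q v * reflProd Q l := by simp [reflProd]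
      rw [h, map_mul, hd, ih, List.length_cons, pow_succ']
  have hne : (-1 : Fˣ) ≠ 1 := by
    intro h
    apply h2
    have h' : (-1 : F) = 1 := by simpa using congrArg Units.val h
    linear_combination -h'
  constructor
  · rintro ⟨l, he, hs, rfl⟩
    exact ⟨by rw [hl, he.neg_one_pow], l, hs, rfl⟩
  · rintro ⟨hg, l, hs, rfl⟩
    refine ⟨l, ?_, hs, rfl⟩
    rw [hl] at hg
    by_contra ho
    rw [(Nat.not_even_iff_odd.1 ho).neg_one_pow] at hg
    exact hne hg

/-- The scalar transformations in `Ω(V, Q)`. -/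
def scalars (Q : QuadraticForm F V) : Subgroup (Omega Q) where
  carrier := {g | ∃ c : F, ∀ x, g.1 x = c • x}
  one_mem' := ⟨1, fun x => (one_smul F x).symm⟩
  mul_mem' := by
    rintro g h ⟨c, hc⟩ ⟨d, hd⟩
    refine ⟨c * d, fun x => ?_⟩
    change g.1 (h.1 x) = _
    rw [hd, hc, mul_smul]
  inv_mem' := by
    rintro g ⟨c, hc⟩
    by_cases h0 : c = 0
    · refine ⟨1, fun x => ?_⟩
      have h : ∀ y : V, y = 0 := fun y => by
        apply g.1.injective
        rw [hc, h0, zero_smul, map_zero]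
      rw [h x, map_zero, smul_zero]
    · refine ⟨c⁻¹, fun x => ?_⟩
      apply g.1.injective
      rw [hc (c⁻¹ • x), smul_smul, mul_inv_cancel₀ h0, one_smul]
      exact g.1.apply_symm_apply x

instance scalars_normal (Q : QuadraticForm F V) : (scalars Q).Normal where
  conj_mem := by
    rintro g ⟨c, hc⟩ h
    refine ⟨c, fun x => ?_⟩
    change h.1 (g.1 (h.1.symm x)) = _
    rw [hc, map_smul, h.1.apply_symm_apply]

/-- The projective group `PΩ(V, Q)`: the quotient of `Ω(V, Q)` by its scalar transformations. -/
abbrev POmega (Q : QuadraticForm F V) : Type _ := Omega Q ⧸ scalars Q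

/-- The image in `PΩ(V, Q)` of the stabilizer in `Ω(V, Q)` of the vector `w`. -/
def stab (Q : QuadraticForm F V) (w : V) : Subgroup (POmega Q) :=
  (MulAction.stabilizer (Omega Q) w).map (QuotientGroup.mk' (scalars Q))

end General

section Standard

variable (F : Type*) [Field F] (n : ℕ)

/-- The quadratic form of plus type `Q(x, y) = ∑ i, x i * y i` in dimension `2 * n`. -/
def plusForm : QuadraticForm F ((Fin n → F) × (Fin n → F)) :=
  ∑ i : Fin n, QuadraticMap.linMulLin
    (LinearMap.proj i ∘ₗ LinearMap.fst F (Fin n → F) (Fin n → F))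
    (LinearMap.proj i ∘ₗ LinearMap.snd F (Fin n → F) (Fin n → F))

theorem plusForm_apply (p : (Fin n → F) × (Fin n → F)) :
    plusForm F n p = ∑ i, p.1 i * p.2 i := by
  simp [plusForm]

/-- The nondegenerate quadratic form `Q(z, x, y) = z ^ 2 + ∑ i, x i * y i` in dimension
`2 * n + 1`. -/
def oddForm : QuadraticForm F (F × ((Fin n → F) × (Fin n → F))) :=
  QuadraticMap.prod QuadraticMap.sq (plusForm F n)

theorem oddForm_apply (p : F × ((Fin n → F) × (Fin n → F))) :
    oddForm F n p = p.1 * p.1 + ∑ i, p.2.1 i * p.2.2 i := by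
  simp [oddForm, plusForm_apply]

end Standard

end FiniteOrthogonal

end

-- Let `n = m - 1`. An element of `Ω` fixing the nonsingular vector `w` acts on `w⊥`, a
-- nondegenerate space of dimension `2n + 1`. All such spaces over a finite field are similar
-- (`Nondeg.exists_similitude`), and `Ω` depends only on the similarity class. Restriction to `w⊥`
-- is injective by a parity count for products of reflections (`restrictPerp_injective`). Its image
-- is all of `Ω(w⊥)`, because isometries in odd dimension are products of reflections and the spinor
-- norm is well defined (`range_restrictPerp`).
--
-- For the exponents it remains to show, prime by prime, that the `r`-part of `exp PΩ⁺(2m, q)`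
-- divides `exp Ω(2n + 1, q)`; evenness of `m` is what makes the smaller space suffice.
--
-- If `r = p` is the characteristic, an element of order `p ^ (b + 1)` has `(g - 1) ^ p ^ b ≠ 0`, so
-- `p ^ b < 2m`. The values `2m - 1` and `2m - 2` are impossible (`char_pow_le`), and an explicit
-- unipotent element in dimension `2n + 1` realizes every remaining order
-- (`pow_dvd_exponent_of_char`).
--
-- If `r` is odd and prime to `q`, some eigenvalue has the full order `r ^ (a + 1)`. Since the
-- spectrum is closed under inversion and Frobenius, this order divides `q ^ d - 1` or `q ^ j + 1`
-- with `d, j ≤ m`. For `d = m` one factors `q ^ m - 1`. The case `j = m` contradicts plus type,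
-- because the number of singular vectors modulo `r` forces a fixed vector. Tori in dimension `2n +
-- 1` supply the orders with index at most `n`.
--
-- If `r = 2` and `q` is odd, let `D` be the largest power of two with `D ≤ m - 1`. Then `D < m -
-- 1`, and `g ^ (q ^ D - 1)` is a scalar (`exists_pow_scalar`), so the projective order divides `q ^
-- D - 1`, which is realized in dimension `2n + 1`.

noncomputable section

namespace FiniteOrthogonal

-- Similitudes and their effect on reflections, spinor norms and `Ω`.

section Basic

variable {F V V' : Type*} [Field F] [AddCommGroup V] [Module F V] [AddCommGroup V'] [Module F V']

/-- A quadratic form is nondegenerate if no nonzero singular vector lies in the radical of the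
polar form. -/
def Nondeg (Q : QuadraticForm F V) : Prop :=
  ∀ x, (∀ y, QuadraticMap.polar Q x y = 0) → Q x = 0 → x = 0

theorem polar_similitude {Q : QuadraticForm F V} {Q' : QuadraticForm F V'} {a : F}
    {φ : V →ₗ[F] V'} (h : ∀ x, Q' (φ x) = a * Q x) (x y : V) :
    QuadraticMap.polar Q' (φ x) (φ y) = a * QuadraticMap.polar Q x y := by
  simp only [QuadraticMap.polar, ← map_add, h]
  ring

theorem polar_GO {Q : QuadraticForm F V} {g : V ≃ₗ[F] V} (hg : g ∈ GO Q) (x y : V) :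
    QuadraticMap.polar Q (g x) (g y) = QuadraticMap.polar Q x y := by
  have h : ∀ x, Q (g x) = Q x := hg
  simp only [QuadraticMap.polar, ← map_add, h]

theorem Nondeg.injective_similitude {Q : QuadraticForm F V} (hQ : Nondeg Q)
    {Q' : QuadraticForm F V'} {a : F} (ha : a ≠ 0) {φ : V →ₗ[F] V'}
    (h : ∀ x, Q' (φ x) = a * Q x) : Function.Injective φ := by
  rw [injective_iff_map_eq_zero]
  intro x hx
  apply hQ
  · intro y
    have := polar_similitude h x y
    rw [hx, QuadraticMap.polar_zero_left] at this
    simpa [ha] using this.symm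
  · have := h x
    rw [hx, map_zero] at this
    simpa [ha] using this.symm

/-- The image of a nonsingular vector under a similitude. -/
def mapVec {Q : QuadraticForm F V} {Q' : QuadraticForm F V'} {a : F} (ha : a ≠ 0)
    {φ : V →ₗ[F] V'} (h : ∀ x, Q' (φ x) = a * Q x) (v : {v : V // Q v ≠ 0}) :
    {v : V' // Q' v ≠ 0} :=
  ⟨φ v.1, by rw [h]; exact mul_ne_zero ha v.2⟩

theorem refl_mapVec {Q : QuadraticForm F V} {Q' : QuadraticForm F V'} {a : F} (ha : a ≠ 0)
    {φ : V →ₗ[F] V'} (h : ∀ x, Q' (φ x) = a * Q x) (v : {v : V // Q v ≠ 0}) (x : V) :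
    refl Q' (mapVec ha h v) (φ x) = φ (refl Q v x) := by
  rw [refl_apply, refl_apply, map_sub, map_smul]
  congr 2
  simp only [mapVec, polar_similitude h, h]
  field_simp

theorem reflProd_cons (Q : QuadraticForm F V) (v : {v : V // Q v ≠ 0})
    (l : List {v : V // Q v ≠ 0}) : reflProd Q (v :: l) = refl Q v * reflProd Q l := by
  simp [reflProd]

theorem reflProd_append (Q : QuadraticForm F V) (l l' : List {v : V // Q v ≠ 0}) :
    reflProd Q (l ++ l') = reflProd Q l * reflProd Q l' := by
  simp [reflProd]

theorem spinorProd_append (Q : QuadraticForm F V) (l l' : List {v : V // Q v ≠ 0}) :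
    spinorProd Q (l ++ l') = spinorProd Q l * spinorProd Q l' := by
  simp [spinorProd]

theorem spinorProd_ne_zero (Q : QuadraticForm F V) (l : List {v : V // Q v ≠ 0}) :
    spinorProd Q l ≠ 0 := by
  induction l with
  | nil => simp [spinorProd]
  | cons v l ih =>
    have : spinorProd Q (v :: l) = Q v.1 * spinorProd Q l := by simp [spinorProd]
    rw [this]
    exact mul_ne_zero v.2 ih

theorem reflProd_mem_GO (Q : QuadraticForm F V) (l : List {v : V // Q v ≠ 0}) :
    reflProd Q l ∈ GO Q := by
  refine Subgroup.list_prod_mem _ ?_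
  intro g hg
  obtain ⟨v, -, rfl⟩ := List.mem_map.1 hg
  exact refl_mem_GO Q v

theorem reflProd_mapVec {Q : QuadraticForm F V} {Q' : QuadraticForm F V'} {a : F} (ha : a ≠ 0)
    {φ : V →ₗ[F] V'} (h : ∀ x, Q' (φ x) = a * Q x) (l : List {v : V // Q v ≠ 0}) (x : V) :
    reflProd Q' (l.map (mapVec ha h)) (φ x) = φ (reflProd Q l x) := by
  induction l with
  | nil => simp [reflProd]
  | cons v l ih =>
    rw [List.map_cons, reflProd_cons, reflProd_cons, LinearEquiv.mul_apply, ih, refl_mapVec,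
      LinearEquiv.mul_apply]

theorem spinorProd_mapVec {Q : QuadraticForm F V} {Q' : QuadraticForm F V'} {a : F} (ha : a ≠ 0)
    {φ : V →ₗ[F] V'} (h : ∀ x, Q' (φ x) = a * Q x) (l : List {v : V // Q v ≠ 0}) :
    spinorProd Q' (l.map (mapVec ha h)) = a ^ l.length * spinorProd Q l := by
  induction l with
  | nil => simp [spinorProd]
  | cons v l ih =>
    have h1 : ∀ l, spinorProd Q (v :: l) = Q v.1 * spinorProd Q l := by simp [spinorProd]
    have h2 : ∀ v l, spinorProd Q' (v :: l) = Q' v.1 * spinorProd Q' l := by simp [spinorProd]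
    rw [List.map_cons, h2, h1, ih, mapVec, h, List.length_cons]
    ring

/-- Conjugation by a linear equivalence. -/
def conjEquiv (φ : V ≃ₗ[F] V') : (V ≃ₗ[F] V) ≃* (V' ≃ₗ[F] V') where
  toFun g := (φ.symm.trans g).trans φ
  invFun g := (φ.trans g).trans φ.symm
  left_inv g := by ext; simp
  right_inv g := by ext; simp
  map_mul' g h := by ext; simp

/-- Rescaling the form leaves reflections unchanged and multiplies the spinor norm by `a ^
l.length`, a square because the length is even. -/
theorem map_conjEquiv_Omega_le {Q : QuadraticForm F V} {Q' : QuadraticForm F V'} {a : F}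
    (ha : a ≠ 0) (φ : V ≃ₗ[F] V') (h : ∀ x, Q' (φ x) = a * Q x) :
    (Omega Q).map (conjEquiv φ).toMonoidHom ≤ Omega Q' := by
  rintro _ ⟨_, ⟨l, hl, hs, rfl⟩, rfl⟩
  refine ⟨l.map (mapVec (φ := φ.toLinearMap) ha h), by simpa using hl, ?_, ?_⟩
  · rw [spinorProd_mapVec]
    exact (hl.isSquare_pow a).mul hs
  · ext y
    obtain ⟨x, rfl⟩ := φ.surjective y
    have := reflProd_mapVec (φ := φ.toLinearMap) ha h l x
    simp only [LinearEquiv.coe_coe] at this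
    rw [this]
    simp [conjEquiv]

theorem map_conjEquiv_Omega {Q : QuadraticForm F V} {Q' : QuadraticForm F V'} {a : F}
    (ha : a ≠ 0) (φ : V ≃ₗ[F] V') (h : ∀ x, Q' (φ x) = a * Q x) :
    (Omega Q).map (conjEquiv φ).toMonoidHom = Omega Q' := by
  refine le_antisymm (map_conjEquiv_Omega_le ha φ h) ?_
  have h' : ∀ y, Q (φ.symm y) = a⁻¹ * Q' y := fun y => by
    have := h (φ.symm y)
    rw [φ.apply_symm_apply] at this
    rw [this]
    field_simp
  intro g hg
  refine ⟨conjEquiv φ.symm g,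
    map_conjEquiv_Omega_le (inv_ne_zero ha) φ.symm h' ⟨g, hg, rfl⟩, ?_⟩
  ext y
  simp [conjEquiv]

/-- A similitude of quadratic spaces induces an isomorphism between their groups `Ω`. -/
def OmegaCongr {Q : QuadraticForm F V} {Q' : QuadraticForm F V'} {a : F}
    (ha : a ≠ 0) (φ : V ≃ₗ[F] V') (h : ∀ x, Q' (φ x) = a * Q x) : Omega Q ≃* Omega Q' :=
  ((conjEquiv φ).subgroupMap (Omega Q)).trans
    (MulEquiv.subgroupCongr (map_conjEquiv_Omega ha φ h))

theorem sq_mem_Omega (Q : QuadraticForm F V) (l : List {v : V // Q v ≠ 0}) :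
    reflProd Q l ^ 2 ∈ Omega Q :=
  ⟨l ++ l, by simp, by rw [spinorProd_append]; exact ⟨_, rfl⟩, by rw [reflProd_append, sq]⟩

end Basic

-- Hyperbolic splitting and similarity of odd-dimensional forms.

section Classification

variable {F : Type*} [Field F]

theorem polar_restrict {V : Type*} [AddCommGroup V] [Module F V] (Q : QuadraticForm F V)
    (U : Submodule F V) (x y : U) :
    QuadraticMap.polar (Q.comp U.subtype) x y = QuadraticMap.polar Q (x : V) (y : V) := by
  simp [QuadraticMap.polar]

/-- Chevalley–Warning: a polynomial of degree at most 2 in at least three variables has a number of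
zeros divisible by `p`, and 0 is one of them. -/
theorem exists_isotropic [Finite F] {W : Type*} [AddCommGroup W] [Module F W]
    [FiniteDimensional F W] (Q : QuadraticForm F W) (h : 3 ≤ Module.finrank F W) :
    ∃ x, x ≠ 0 ∧ Q x = 0 := by
  classical
  have := Fintype.ofFinite F
  obtain ⟨p, hp⟩ := CharP.exists F
  have hp' : Fact p.Prime := ⟨CharP.char_is_prime F p⟩
  obtain ⟨B, rfl⟩ := LinearMap.BilinMap.toQuadraticMap_surjective (R := F) Q
  let b := Module.finBasis F W
  let f : MvPolynomial (Fin (Module.finrank F W)) F :=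
    ∑ i, ∑ j, MvPolynomial.C (B (b i) (b j)) * (MvPolynomial.X i * MvPolynomial.X j)
  have hf : f.totalDegree < Fintype.card (Fin (Module.finrank F W)) := by
    rw [Fintype.card_fin]
    refine lt_of_le_of_lt (b := 2) ?_ (by omega)
    refine (MvPolynomial.totalDegree_finsetSum _ _).trans (Finset.sup_le fun i _ => ?_)
    refine (MvPolynomial.totalDegree_finsetSum _ _).trans (Finset.sup_le fun j _ => ?_)
    refine (MvPolynomial.totalDegree_mul _ _).trans ?_
    rw [MvPolynomial.totalDegree_C, zero_add]
    refine (MvPolynomial.totalDegree_mul _ _).trans ?_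
    simp [MvPolynomial.totalDegree_X]
  have hd := char_dvd_card_solutions p hf
  have heval : ∀ x, MvPolynomial.eval x f = B (b.equivFun.symm x) (b.equivFun.symm x) := by
    intro x
    simp only [f, map_sum, map_mul, MvPolynomial.eval_C, MvPolynomial.eval_X,
      Module.Basis.equivFun_symm_apply, LinearMap.sum_apply, map_smul, LinearMap.smul_apply,
      smul_eq_mul]
    rw [Finset.sum_comm]
    refine Finset.sum_congr rfl fun i _ => ?_
    rw [Finset.mul_sum]
    refine Finset.sum_congr rfl fun j _ => ?_
    ring
  have h1 : 1 < Fintype.card {x // MvPolynomial.eval x f = 0} := by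
    have h0 : MvPolynomial.eval 0 f = 0 := by rw [heval]; simp
    have : 0 < Fintype.card {x // MvPolynomial.eval x f = 0} :=
      Fintype.card_pos_iff.2 ⟨⟨0, h0⟩⟩
    exact lt_of_lt_of_le hp'.out.one_lt (Nat.le_of_dvd this hd)
  have h0 : MvPolynomial.eval 0 f = 0 := by rw [heval]; simp
  obtain ⟨⟨x, hx⟩, hne⟩ := Fintype.exists_ne_of_one_lt_card h1 ⟨0, h0⟩
  refine ⟨b.equivFun.symm x, ?_, ?_⟩
  · intro h
    apply hne
    rw [Subtype.mk.injEq]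
    exact (LinearEquiv.map_eq_zero_iff _).1 h
  · rw [LinearMap.BilinMap.toQuadraticMap_apply, ← heval, hx]

theorem Nondeg.exists_hyperbolic {W : Type*} [AddCommGroup W] [Module F W]
    {Q : QuadraticForm F W} (hQ : Nondeg Q) {x : W} (hx : x ≠ 0) (h : Q x = 0) :
    ∃ y, Q y = 0 ∧ QuadraticMap.polar Q x y = 1 := by
  obtain ⟨y, hy⟩ : ∃ y, QuadraticMap.polar Q x y ≠ 0 := by
    by_contra! hc
    exact hx (hQ x hc h)
  obtain ⟨y₁, h1⟩ : ∃ y₁, QuadraticMap.polar Q x y₁ = 1 :=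
    ⟨(QuadraticMap.polar Q x y)⁻¹ • y, by simp [QuadraticMap.polar_smul_right, hy]⟩
  have hxx : QuadraticMap.polar Q x x = 0 := by
    rw [QuadraticMap.polar_self, h, smul_zero]
  refine ⟨y₁ + (-Q y₁) • x, ?_, ?_⟩
  · rw [QuadraticMap.map_add Q, QuadraticMap.map_smul, QuadraticMap.polar_smul_right,
      QuadraticMap.polar_comm Q y₁ x, h1, h]
    simp
  · rw [QuadraticMap.polar_add_right, QuadraticMap.polar_smul_right, hxx, h1]
    simp

/-- The orthogonal complement of a pair of vectors. -/
def pairPerp {W : Type*} [AddCommGroup W] [Module F W] (Q : QuadraticForm F W) (x y : W) :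
    Submodule F W :=
  LinearMap.ker ((Q.polarBilin x).prod (Q.polarBilin y))

theorem mem_pairPerp {W : Type*} [AddCommGroup W] [Module F W] {Q : QuadraticForm F W}
    {x y w : W} : w ∈ pairPerp Q x y ↔
      QuadraticMap.polar Q x w = 0 ∧ QuadraticMap.polar Q y w = 0 := by
  simp [pairPerp]

variable {W : Type*} [AddCommGroup W] [Module F W] {Q : QuadraticForm F W} {x y : W}

/-- The projection to the orthogonal complement of a hyperbolic pair. -/
def pairProj (Q : QuadraticForm F W) {x y : W} (hx : Q x = 0) (hy : Q y = 0)
    (hxy : QuadraticMap.polar Q x y = 1) : W →ₗ[F] pairPerp Q x y :=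
  LinearMap.codRestrict _ (LinearMap.id - (Q.polarBilin y).smulRight x -
    (Q.polarBilin x).smulRight y) fun w => by
      have hxx : QuadraticMap.polar Q x x = 0 := by
        rw [QuadraticMap.polar_self, hx, smul_zero]
      have hyy : QuadraticMap.polar Q y y = 0 := by
        rw [QuadraticMap.polar_self, hy, smul_zero]
      have hyx : QuadraticMap.polar Q y x = 1 := by
        rw [QuadraticMap.polar_comm, hxy]
      rw [mem_pairPerp]
      simp [QuadraticMap.polar_sub_right, QuadraticMap.polar_smul_right, hxx, hyy, hxy, hyx]

theorem pairProj_eq (hx : Q x = 0) (hy : Q y = 0)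
    (hxy : QuadraticMap.polar Q x y = 1) (w : W) :
    w = QuadraticMap.polar Q y w • x + QuadraticMap.polar Q x w • y +
      (pairProj Q hx hy hxy w : W) := by
  simp [pairProj]

theorem map_pairProj (hx : Q x = 0) (hy : Q y = 0)
    (hxy : QuadraticMap.polar Q x y = 1) (w : W) :
    Q w = QuadraticMap.polar Q y w * QuadraticMap.polar Q x w +
      Q (pairProj Q hx hy hxy w : W) := by
  have hm := mem_pairPerp.1 (pairProj Q hx hy hxy w).2
  conv_lhs => rw [pairProj_eq hx hy hxy w]
  rw [QuadraticMap.map_add Q, QuadraticMap.map_add Q, QuadraticMap.map_smul,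
    QuadraticMap.map_smul, QuadraticMap.polar_smul_right, QuadraticMap.polar_smul_left,
    QuadraticMap.polar_add_left, QuadraticMap.polar_smul_left, QuadraticMap.polar_smul_left,
    hm.1, hm.2, hx, hy, hxy]
  simp
  ring

theorem finrank_pairPerp [FiniteDimensional F W] (hx : Q x = 0) (hy : Q y = 0)
    (hxy : QuadraticMap.polar Q x y = 1) :
    Module.finrank F (pairPerp Q x y) + 2 = Module.finrank F W := by
  have hxx : QuadraticMap.polar Q x x = 0 := by
    rw [QuadraticMap.polar_self, hx, smul_zero]
  have hyy : QuadraticMap.polar Q y y = 0 := by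
    rw [QuadraticMap.polar_self, hy, smul_zero]
  have hyx : QuadraticMap.polar Q y x = 1 := by
    rw [QuadraticMap.polar_comm, hxy]
  have hs : LinearMap.range ((Q.polarBilin x).prod (Q.polarBilin y)) = ⊤ := by
    rw [LinearMap.range_eq_top]
    rintro ⟨α, β⟩
    refine ⟨β • x + α • y, ?_⟩
    simp [QuadraticMap.polar_add_right, QuadraticMap.polar_smul_right, hxx, hyy, hxy, hyx]
  have := LinearMap.finrank_range_add_finrank_ker ((Q.polarBilin x).prod (Q.polarBilin y))
  rw [hs, finrank_top, Module.finrank_prod, Module.finrank_self] at this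
  rw [pairPerp, ← this]
  ring

theorem Nondeg.pairPerp (hQ : Nondeg Q) (hx : Q x = 0) (hy : Q y = 0)
    (hxy : QuadraticMap.polar Q x y = 1) :
    Nondeg (Q.comp (pairPerp Q x y).subtype) := by
  intro u hu hQu
  have hm := mem_pairPerp.1 u.2
  refine Subtype.ext (hQ u.1 ?_ hQu)
  intro w
  have := hu (pairProj Q hx hy hxy w)
  rw [polar_restrict] at this
  rw [pairProj_eq hx hy hxy w, QuadraticMap.polar_add_right, this, QuadraticMap.polar_add_right,
    QuadraticMap.polar_smul_right, QuadraticMap.polar_smul_right, QuadraticMap.polar_comm _ _ x,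
    QuadraticMap.polar_comm _ _ y, hm.1, hm.2]
  simp

/-- Hyperbolic planes are split off until a line remains. The scale `a` normalizes the form on that
line; on each plane it is absorbed into one of the two coordinates. -/
theorem Nondeg.exists_functionals [Finite F] (n : ℕ) :
    ∀ {W : Type*} [AddCommGroup W] [Module F W] [FiniteDimensional F W]
      {Q : QuadraticForm F W}, Nondeg Q → Module.finrank F W = 2 * n + 1 →
      ∃ a : F, a ≠ 0 ∧ ∃ z : Module.Dual F W, ∃ x y : Fin n → Module.Dual F W,
        ∀ w, a * Q w = z w * z w + ∑ i, x i w * y i w := by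
  induction n with
  | zero =>
    intro W _ _ _ Q hQ hW
    let φ : W ≃ₗ[F] F := LinearEquiv.ofFinrankEq W F (by simp [hW])
    have h : ∀ w, Q w = φ w * φ w * Q (φ.symm 1) := fun w => by
      conv_lhs => rw [← φ.symm_apply_apply w, ← mul_one (φ w), ← smul_eq_mul, map_smul,
        QuadraticMap.map_smul]
      rw [smul_eq_mul]
    have h1 : Q (φ.symm 1) ≠ 0 := fun h0 => by
      have hz : ∀ w, Q w = 0 := fun w => by rw [h, h0, mul_zero]
      have h2 : φ.symm 1 = 0 := hQ _ (fun y => by simp [QuadraticMap.polar, hz]) (hz _)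
      have : (1 : F) = 0 := by simp at h2
      exact one_ne_zero this
    refine ⟨(Q (φ.symm 1))⁻¹, inv_ne_zero h1, φ, fun _ => 0, fun _ => 0, fun w => ?_⟩
    rw [h w]
    simp
    field_simp
  | succ n ih =>
    intro W _ _ _ Q hQ hW
    obtain ⟨x, hx0, hx⟩ := exists_isotropic Q (by omega)
    obtain ⟨y, hy, hxy⟩ := hQ.exists_hyperbolic hx0 hx
    have hU := finrank_pairPerp hx hy hxy
    obtain ⟨a, ha, z, xs, ys, h⟩ := ih (hQ.pairPerp hx hy hxy) (by omega)
    let π := pairProj Q hx hy hxy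
    refine ⟨a, ha, z ∘ₗ π, Fin.cons (a • Q.polarBilin y) (fun i => xs i ∘ₗ π),
      Fin.cons (Q.polarBilin x) (fun i => ys i ∘ₗ π), fun w => ?_⟩
    rw [map_pairProj hx hy hxy w, mul_add, Fin.sum_univ_succ]
    have := h (π w)
    simp only [QuadraticMap.comp_apply, Submodule.subtype_apply, π] at this
    rw [this]
    simp [π]
    ring

/-- Over a finite field all nondegenerate quadratic forms in dimension `2 * n + 1` are similar. -/
theorem Nondeg.exists_similitude [Finite F] [FiniteDimensional F W] {n : ℕ} (hQ : Nondeg Q)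
    (h : Module.finrank F W = 2 * n + 1) :
    ∃ a : F, a ≠ 0 ∧ ∃ φ : W ≃ₗ[F] F × ((Fin n → F) × (Fin n → F)),
      ∀ w, oddForm F n (φ w) = a * Q w := by
  obtain ⟨a, ha, z, x, y, hz⟩ := hQ.exists_functionals n h
  let φ : W →ₗ[F] F × ((Fin n → F) × (Fin n → F)) :=
    z.prod ((LinearMap.pi x).prod (LinearMap.pi y))
  have hφ : ∀ w, oddForm F n (φ w) = a * Q w := fun w => by
    rw [hz, oddForm_apply]
    rfl
  refine ⟨a, ha, LinearMap.linearEquivOfInjective φ (hQ.injective_similitude ha hφ) ?_, hφ⟩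
  simp [h]
  ring

end Classification

open QuadraticMap

-- Generation of odd-dimensional isometry groups by reflections.

section CartanDieudonne

variable {F V : Type*} [Field F] [AddCommGroup V] [Module F V] {Q : QuadraticForm F V}

/-- The group of all products of reflections. -/
def reflSubgroup (Q : QuadraticForm F V) : Subgroup (V ≃ₗ[F] V) where
  carrier := {g | ∃ l, reflProd Q l = g}
  one_mem' := ⟨[], by simp [reflProd]⟩
  mul_mem' := by
    rintro _ _ ⟨l, rfl⟩ ⟨l', rfl⟩
    exact ⟨l ++ l', reflProd_append Q l l'⟩
  inv_mem' := by
    rintro _ ⟨l, rfl⟩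
    exact ⟨l.reverse, by simp [reflProd, List.prod_inv_reverse, Function.comp_def, refl_inv]⟩

theorem refl_mem_reflSubgroup (v : {v : V // Q v ≠ 0}) : refl Q v ∈ reflSubgroup Q :=
  ⟨[v], by simp [reflProd]⟩

theorem reflSubgroup_le_GO : reflSubgroup Q ≤ GO Q := by
  rintro _ ⟨l, rfl⟩
  exact reflProd_mem_GO Q l

theorem refl_apply_of_polar_eq_zero (v : {v : V // Q v ≠ 0}) {x : V} (h : polar Q v.1 x = 0) :
    refl Q v x = x := by
  rw [refl_apply, h, mul_zero, zero_smul, sub_zero]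

/-- This identity makes the coefficient in the reflection along `x - y` equal to 1 at `x`, so that
`x` goes to `y`. -/
theorem map_sub_eq {x y : V} (h : Q x = Q y) : Q (x - y) = polar Q (x - y) x := by
  rw [polar_sub_left, polar_self, polar_comm Q y x, sub_eq_add_neg, QuadraticMap.map_add Q,
    QuadraticMap.map_neg, polar_neg_right, ← h]
  simp
  ring

/-- A reflection moving a vector to another one of the same norm. -/
theorem exists_refl_apply_eq {x y : V} (h : Q x = Q y) (hxy : Q (x - y) ≠ 0) :
    ∃ r ∈ reflSubgroup Q, r x = y ∧ ∀ u, polar Q x u = polar Q y u → r u = u := by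
  refine ⟨refl Q ⟨x - y, hxy⟩, refl_mem_reflSubgroup _, ?_, fun u hu => ?_⟩
  · rw [refl_apply]
    simp only
    rw [← map_sub_eq h, inv_mul_cancel₀ hxy, one_smul, sub_sub_cancel]
  · apply refl_apply_of_polar_eq_zero
    simp only
    rw [polar_sub_left, hu, sub_self]

/-- By the parallelogram law `Q (x - y)` and `Q (x + y)` sum to `4 * Q x ≠ 0`, so one of them is
nonzero. Either reflect `x` directly to `y`, or to `-y` and then negate by the reflection in `y`. -/
theorem exists_mem_reflSubgroup_of_two_ne_zero (h2 : (2 : F) ≠ 0) {x y : V} (h : Q x = Q y)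
    (hx : Q x ≠ 0) :
    ∃ r ∈ reflSubgroup Q, r x = y ∧ ∀ u, polar Q x u = 0 → polar Q y u = 0 → r u = u := by
  by_cases hxy : Q (x - y) = 0
  · have hy : Q x = Q (-y) := by rw [QuadraticMap.map_neg, h]
    have hs : Q (x - -y) ≠ 0 := by
      rw [sub_neg_eq_add, QuadraticMap.map_add Q]
      rw [sub_eq_add_neg, QuadraticMap.map_add Q, QuadraticMap.map_neg, polar_neg_right] at hxy
      intro h0
      apply mul_ne_zero (mul_ne_zero h2 h2) hx
      linear_combination h0 + hxy + 2 * h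
    obtain ⟨r, hr, hrx, hru⟩ := exists_refl_apply_eq hy hs
    have hy0 : Q y ≠ 0 := h ▸ hx
    refine ⟨refl Q ⟨y, hy0⟩ * r, mul_mem (refl_mem_reflSubgroup _) hr, ?_, fun u hu hu' => ?_⟩
    · rw [LinearEquiv.mul_apply, hrx, refl_apply]
      simp only
      have hc : (Q y)⁻¹ * -(2 • Q y) = -2 := by
        rw [nsmul_eq_mul]
        field_simp
        simp
      rw [polar_neg_right, polar_self, hc]
      module
    · rw [LinearEquiv.mul_apply, hru u (by rw [hu, polar_neg_left, hu', neg_zero])]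
      exact refl_apply_of_polar_eq_zero _ hu'
  · obtain ⟨r, hr, hrx, hru⟩ := exists_refl_apply_eq h hxy
    exact ⟨r, hr, hrx, fun u hu hu' => hru u (by rw [hu, hu'])⟩

theorem map_sub_of_two_eq_zero (h2 : (2 : F) = 0) {x y : V} (h : Q x = Q y) :
    Q (x - y) = - polar Q x y := by
  rw [sub_eq_add_neg, QuadraticMap.map_add Q, QuadraticMap.map_neg, polar_neg_right, ← h]
  linear_combination Q x * h2

/-- In characteristic two a reflection joins two vectors of equal norm only when they are not
orthogonal; `z` is an intermediate stop avoiding this obstruction. -/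
theorem exists_mem_reflSubgroup_of_polar (h2 : (2 : F) = 0) {x y z : V} (hz : Q x = Q z)
    (h : Q x = Q y) (hxz : polar Q x z ≠ 0) (hzy : polar Q z y ≠ 0) :
    ∃ r ∈ reflSubgroup Q, r x = y ∧
      ∀ u, polar Q x u = polar Q z u → polar Q z u = polar Q y u → r u = u := by
  obtain ⟨r, hr, hrx, hru⟩ := exists_refl_apply_eq hz
    (by rw [map_sub_of_two_eq_zero h2 hz]; exact neg_ne_zero.2 hxz)
  obtain ⟨s, hs, hsx, hsu⟩ := exists_refl_apply_eq (hz.symm.trans h)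
    (by rw [map_sub_of_two_eq_zero h2 (hz.symm.trans h)]; exact neg_ne_zero.2 hzy)
  refine ⟨s * r, mul_mem hs hr, by rw [LinearEquiv.mul_apply, hrx, hsx], fun u hu hu' => ?_⟩
  rw [LinearEquiv.mul_apply, hru u hu, hsu u hu']

variable [Finite F]

/-- In characteristic two, adding a multiple of a nonsingular radical vector changes the value
of the form arbitrarily. -/
theorem exists_add_radical (h2 : (2 : F) = 0) {w₀ : V} (hw : Q w₀ ≠ 0)
    (hr : ∀ y, polar Q w₀ y = 0) (z : V) (c : F) :
    ∃ z', Q z' = c ∧ (∀ y, polar Q z' y = polar Q z y) ∧ ∃ t : F, z' = z + t • w₀ := by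
  have hc : CharP F 2 := CharTwo.of_one_ne_zero_of_two_eq_zero one_ne_zero h2
  obtain ⟨t, ht⟩ := FiniteField.isSquare_of_char_two (ringChar.eq F 2 ▸ rfl) ((c - Q z) / Q w₀)
  refine ⟨z + t • w₀, ?_, fun y => ?_, t, rfl⟩
  · rw [QuadraticMap.map_add Q, QuadraticMap.map_smul, polar_smul_right, polar_comm, hr,
      smul_eq_mul, ← ht]
    field_simp
    simp
  · rw [polar_add_left, polar_smul_left, hr, smul_zero, add_zero]

theorem exists_mem_reflSubgroup_of_two_eq_zero (h2 : (2 : F) = 0) {w₀ : V} (hw : Q w₀ ≠ 0)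
    (hr : ∀ y, polar Q w₀ y = 0) {D : Submodule F V} (hwD : w₀ ∈ D) {x y a b : V} (h : Q x = Q y)
    (ha : a ∈ D) (hb : b ∈ D) (hx : polar Q x a ≠ 0) (hy : polar Q y b ≠ 0) :
    ∃ r ∈ reflSubgroup Q, r x = y ∧ ∀ u, (∀ d ∈ D, polar Q d u = 0) →
      polar Q x u = 0 → polar Q y u = 0 → r u = u := by
  -- One of `a`, `b`, `a + b` is orthogonal to neither vector. A radical multiple of `w₀` then
  -- corrects its norm without changing any polar value.
  obtain ⟨z, hz, hxz, hyz⟩ : ∃ z ∈ D, polar Q x z ≠ 0 ∧ polar Q y z ≠ 0 := by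
    by_cases h1 : polar Q y a = 0
    · by_cases h3 : polar Q x b = 0
      · refine ⟨a + b, add_mem ha hb, ?_, ?_⟩
        · rwa [polar_add_right, h3, add_zero]
        · rwa [polar_add_right, h1, zero_add]
      · exact ⟨b, hb, h3, hy⟩
    · exact ⟨a, ha, hx, h1⟩
  obtain ⟨z', hz', hp, t, rfl⟩ := exists_add_radical h2 hw hr z (Q x)
  obtain ⟨r, hr, hrx, hru⟩ := exists_mem_reflSubgroup_of_polar h2 (x := x) (y := y) hz'.symm h
    (by rw [polar_comm, hp, polar_comm]; exact hxz) (by rw [hp, polar_comm]; exact hyz)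
  refine ⟨r, hr, hrx, fun u hu hxu hyu => ?_⟩
  have : polar Q (z + t • w₀) u = 0 := hu _ (add_mem hz (D.smul_mem t hwD))
  exact hru u (by rw [this, hxu]) (by rw [this, hyu])

theorem exists_mem_reflSubgroup_fixing (h2 : (2 : F) = 0) {w₀ : V} (hw : Q w₀ ≠ 0)
    (hr : ∀ y, polar Q w₀ y = 0) {x y y' : V} (h : Q y = Q y') (hy : polar Q x y = 1)
    (hy' : polar Q x y' = 1) :
    ∃ r ∈ reflSubgroup Q, r y = y' ∧ r x = x ∧ ∀ u, polar Q x u = 0 →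
      polar Q y u = 0 → polar Q y' u = 0 → r u = u := by
  by_cases hyy : polar Q y y' = 0
  -- The detour goes through a vector with the pairings of `x + y`: since `polar Q x x = 0`, it
  -- pairs to 1 with `x`, so both reflections fix `x`.
  · obtain ⟨z, hz, hp, -⟩ := exists_add_radical h2 hw hr (x + y) (Q y)
    have hxx : polar Q x x = 0 := by rw [polar_self, nsmul_eq_mul]; simp [h2]
    obtain ⟨r, hr, hrx, hru⟩ := exists_mem_reflSubgroup_of_polar h2 (x := y) (y := y') hz.symm h
      (by rw [polar_comm, hp, polar_add_left, polar_self, hy, nsmul_eq_mul]; simp [h2])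
      (by rw [hp, polar_add_left, hyy, hy']; simp)
    refine ⟨r, hr, hrx, hru x ?_ ?_, fun u hx hyu hyu' => hru u ?_ ?_⟩
    · rw [hp, polar_add_left, hxx, zero_add]
    · rw [hp, polar_add_left, hxx, zero_add, polar_comm, hy, polar_comm, hy']
    · rw [hp, polar_add_left, hx, zero_add]
    · rw [hp, polar_add_left, hx, zero_add, hyu, hyu']
  · obtain ⟨r, hr, hrx, hru⟩ := exists_refl_apply_eq h
      (by rw [map_sub_of_two_eq_zero h2 h]; exact neg_ne_zero.2 hyy)
    refine ⟨r, hr, hrx, hru x (by rw [polar_comm, hy, polar_comm, hy']), fun u _ hu hu' =>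
      hru u (by rw [hu, hu'])⟩

/-- Induction on the codimension of a pointwise fixed subspace `U` with `V = U + U⊥`. The sum need
not be direct, which allows for a radical. Reflections fixing `U` bring back the image of a
nonsingular vector of `U⊥` or, in characteristic two, of a pair in `U⊥` with pairing 1. The
nonsingular radical vector supplies the intermediate vectors in the latter case. -/
theorem mem_reflSubgroup_of_fixes [FiniteDimensional F V] (hQ : Nondeg Q)
    (hrad : (2 : F) = 0 → ∃ w, Q w ≠ 0 ∧ ∀ y, polar Q w y = 0) (k : ℕ) :
    ∀ (U : Submodule F V), Module.finrank F V ≤ Module.finrank F U + k →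
      (∀ w, ∃ u ∈ U, ∃ d, (∀ u ∈ U, polar Q d u = 0) ∧ w = u + d) →
      ∀ g ∈ GO Q, (∀ u ∈ U, g u = u) → g ∈ reflSubgroup Q := by
  induction k with
  | zero =>
    intro U hU _ g _ hfix
    have : U = ⊤ := Submodule.eq_top_of_finrank_eq (le_antisymm (Submodule.finrank_le U) hU)
    subst this
    have : g = 1 := by
      ext x
      exact hfix x trivial
    rw [this]
    exact one_mem _
  | succ k ih =>
    intro U hU hdec g hg hfix
    have hperp : ∀ d, (∀ u ∈ U, polar Q d u = 0) → ∀ u ∈ U, polar Q (g d) u = 0 := by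
      intro d hd u hu
      have := polar_GO hg d u
      rw [hfix u hu, hd u hu] at this
      exact this
    -- If `U⊥` is radical, then `g d - d` is radical and singular, hence zero, for `d` in `U⊥`.
    by_cases hD : ∀ d, (∀ u ∈ U, polar Q d u = 0) → ∀ y, polar Q d y = 0
    · have : g = 1 := by
        ext x
        obtain ⟨u, hu, d, hd, rfl⟩ := hdec x
        have h1 := hD d hd
        have h2 := hD _ (hperp d hd)
        have h3 : g d - d = 0 := by
          apply hQ
          · intro y
            rw [polar_sub_left, h1, h2, sub_zero]
          · rw [map_sub_eq (hg d), polar_sub_left, h1, h2, sub_zero]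
        rw [map_add, hfix u hu, sub_eq_zero.1 h3]
        rfl
      rw [this]
      exact one_mem _
    · push Not at hD
      obtain ⟨x, hx, y₀, hy₀⟩ := hD
      by_cases h2 : (2 : F) = 0
      · obtain ⟨w₀, hw, hr⟩ := hrad h2
        let D : Submodule F V :=
          { carrier := {d | ∀ u ∈ U, polar Q d u = 0}
            add_mem' := fun {a b} ha hb u hu => by rw [polar_add_left, ha u hu, hb u hu, add_zero]
            zero_mem' := fun u _ => polar_zero_left Q u
            smul_mem' := fun c a ha u hu => by rw [polar_smul_left, ha u hu, smul_zero] }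
        obtain ⟨y, hy, hxy⟩ : ∃ y ∈ D, polar Q x y = 1 := by
          obtain ⟨u, hu, d, hd, rfl⟩ := hdec y₀
          rw [polar_add_right, hx u hu, zero_add] at hy₀
          refine ⟨(polar Q x d)⁻¹ • d, D.smul_mem _ hd, ?_⟩
          rw [polar_smul_right, smul_eq_mul, inv_mul_cancel₀ hy₀]
        have hyx : polar Q y x = 1 := by rw [polar_comm, hxy]
        have hxx : ∀ x, polar Q x x = 0 := fun x => by rw [polar_self, nsmul_eq_mul]; simp [h2]
        have hDu : ∀ u ∈ U, ∀ d ∈ D, polar Q d u = 0 := fun u hu d hd => hd u hu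
        have hgxy : polar Q (g x) (g y) = 1 := by rw [polar_GO hg, hxy]
        obtain ⟨r, hr1, hrx, hru⟩ := exists_mem_reflSubgroup_of_two_eq_zero h2 hw hr
          (D := D) (fun u _ => hr u) (x := g x) (y := x) (a := g y) (b := y) (hg x)
          (hperp y hy) hy (by rw [hgxy]; exact one_ne_zero) (by rw [hxy]; exact one_ne_zero)
        have hrU : ∀ u ∈ U, r u = u := fun u hu =>
          hru u (hDu u hu) (hperp x hx u hu) (hx u hu)
        have hrg : r * g ∈ GO Q := mul_mem (reflSubgroup_le_GO hr1) hg
        have hrgy : ∀ u ∈ U, polar Q ((r * g) y) u = 0 := fun u hu => by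
          have := polar_GO hrg y u
          rw [LinearEquiv.mul_apply r g u, hfix u hu, hrU u hu, hy u hu] at this
          exact this
        obtain ⟨s, hs, hsy, hsx, hsu⟩ := exists_mem_reflSubgroup_fixing h2 hw hr
          (x := x) (y := (r * g) y) (y' := y) (hrg y)
          (by
            have := polar_GO hrg x y
            rwa [LinearEquiv.mul_apply r g x, hrx, hxy] at this) hxy
        have hmain : s * (r * g) ∈ reflSubgroup Q := by
          refine ih (U ⊔ Submodule.span F {x, y}) ?_ ?_ _ (mul_mem (reflSubgroup_le_GO hs) hrg) ?_
          · have hlt : U < U ⊔ Submodule.span F {x, y} := by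
              refine lt_of_le_of_ne le_sup_left fun h => ?_
              have hxU : x ∈ U := by
                rw [h]
                exact Submodule.mem_sup_right (Submodule.subset_span (by simp))
              rw [hy x hxU] at hyx
              exact zero_ne_one hyx
            have := Submodule.finrank_lt_finrank_of_lt hlt
            omega
          · intro w
            obtain ⟨u, hu, d, hd, rfl⟩ := hdec w
            refine ⟨u + (polar Q d y • x + polar Q d x • y), add_mem
              (Submodule.mem_sup_left hu) (Submodule.mem_sup_right
                (Submodule.mem_span_pair.2 ⟨_, _, rfl⟩)),
              d - (polar Q d y • x + polar Q d x • y), ?_, by abel⟩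
            intro v hv
            obtain ⟨u', hu', v', hv', rfl⟩ := Submodule.mem_sup.1 hv
            obtain ⟨a, b, rfl⟩ := Submodule.mem_span_pair.1 hv'
            simp only [polar_sub_left, polar_add_left, polar_smul_left, polar_add_right,
              polar_smul_right, hxx, hxy, hyx, hd u' hu', hx u' hu', hy u' hu', smul_eq_mul]
            ring
          · intro v hv
            obtain ⟨u', hu', v', hv', rfl⟩ := Submodule.mem_sup.1 hv
            obtain ⟨a, b, rfl⟩ := Submodule.mem_span_pair.1 hv'
            have e1 : (s * (r * g)) u' = u' := by
              rw [LinearEquiv.mul_apply, LinearEquiv.mul_apply, hfix u' hu', hrU u' hu']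
              exact hsu u' (hx u' hu') (hrgy u' hu') (hy u' hu')
            have e2 : (s * (r * g)) x = x := by
              rw [LinearEquiv.mul_apply, LinearEquiv.mul_apply, hrx, hsx]
            have e3 : (s * (r * g)) y = y := by
              rw [LinearEquiv.mul_apply, hsy]
            rw [map_add, map_add, map_smul, map_smul, e1, e2, e3]
        have := mul_mem (inv_mem hr1) (mul_mem (inv_mem hs) hmain)
        rwa [inv_mul_cancel_left, inv_mul_cancel_left] at this
      · obtain ⟨z, hz, hzz⟩ : ∃ z, (∀ u ∈ U, polar Q z u = 0) ∧ Q z ≠ 0 := by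
          by_contra! hc
          obtain ⟨u, hu, d, hd, rfl⟩ := hdec y₀
          rw [polar_add_right, hx u hu, zero_add] at hy₀
          apply hy₀
          rw [polar, hc x hx, hc d hd, hc (x + d)]
          · simp
          · intro u hu
            rw [polar_add_left, hx u hu, hd u hu, add_zero]
        have hzz' : polar Q z z ≠ 0 := by
          rw [polar_self, nsmul_eq_mul]
          exact mul_ne_zero (by exact_mod_cast h2) hzz
        obtain ⟨r, hr, hrz, hru⟩ := exists_mem_reflSubgroup_of_two_ne_zero h2 (x := g z) (y := z)
          (hg z) (by rw [hg z]; exact hzz)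
        have hmain : r * g ∈ reflSubgroup Q := by
          refine ih (U ⊔ Submodule.span F {z}) ?_ ?_ _ (mul_mem (reflSubgroup_le_GO hr) hg) ?_
          · have hlt : U < U ⊔ Submodule.span F {z} := by
              refine lt_of_le_of_ne le_sup_left fun h => ?_
              have hzU : z ∈ U := by
                rw [h]
                exact Submodule.mem_sup_right (Submodule.subset_span (by simp))
              exact hzz' (hz z hzU)
            have := Submodule.finrank_lt_finrank_of_lt hlt
            omega
          · intro w
            obtain ⟨u, hu, d, hd, rfl⟩ := hdec w
            refine ⟨u + (polar Q d z / polar Q z z) • z, add_mem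
              (Submodule.mem_sup_left hu) (Submodule.mem_sup_right
                (Submodule.mem_span_singleton.2 ⟨_, rfl⟩)),
              d - (polar Q d z / polar Q z z) • z, ?_, by abel⟩
            intro v hv
            obtain ⟨u', hu', v', hv', rfl⟩ := Submodule.mem_sup.1 hv
            obtain ⟨a, rfl⟩ := Submodule.mem_span_singleton.1 hv'
            simp only [polar_sub_left, polar_smul_left, polar_add_right,
              polar_smul_right, hd u' hu', hz u' hu', smul_eq_mul]
            field_simp
            ring
          · intro v hv
            obtain ⟨u', hu', v', hv', rfl⟩ := Submodule.mem_sup.1 hv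
            obtain ⟨a, rfl⟩ := Submodule.mem_span_singleton.1 hv'
            rw [LinearEquiv.mul_apply, map_add, map_smul, hfix u' hu', map_add, map_smul, hrz,
              hru u' (hperp z hz u' hu') (hz u' hu')]
        have := mul_mem (inv_mem hr) hmain
        rwa [inv_mul_cancel_left] at this

/-- In characteristic two, a nondegenerate form in odd dimension has a nonsingular radical
vector. -/
theorem Nondeg.exists_radical [FiniteDimensional F V] (hQ : Nondeg Q) {n : ℕ}
    (h : Module.finrank F V = 2 * n + 1) (h2 : (2 : F) = 0) :
    ∃ w, Q w ≠ 0 ∧ ∀ y, polar Q w y = 0 := by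
  obtain ⟨a, ha, φ, hφ⟩ := hQ.exists_similitude h
  refine ⟨φ.symm (1, 0), ?_, fun y => ?_⟩
  · have := hφ (φ.symm (1, 0))
    rw [φ.apply_symm_apply, oddForm_apply] at this
    intro h0
    rw [h0] at this
    simp at this
  · have := polar_similitude (φ := φ.toLinearMap) hφ (φ.symm (1, 0)) y
    have h0 : polar (oddForm F n) (1, 0) (φ y) = 0 := by
      simp only [polar, oddForm_apply]
      simp
      linear_combination (φ y).1 * h2
    simp only [LinearEquiv.coe_coe, φ.apply_symm_apply] at this
    rw [h0] at this
    simpa [ha] using this.symm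

/-- Every isometry of a nondegenerate odd-dimensional quadratic space over a finite field is a
product of reflections. -/
theorem Nondeg.exists_reflProd [FiniteDimensional F V] (hQ : Nondeg Q) {n : ℕ}
    (h : Module.finrank F V = 2 * n + 1) {g : V ≃ₗ[F] V} (hg : g ∈ GO Q) :
    ∃ l, reflProd Q l = g := by
  refine mem_reflSubgroup_of_fixes hQ (hQ.exists_radical h) (Module.finrank F V) ⊥
    (Nat.le_add_left _ _) (fun w => ⟨0, zero_mem _, w, ?_, (zero_add w).symm⟩) g hg ?_
  · rintro u hu
    rw [(Submodule.mem_bot F).1 hu, polar_zero_right]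
  · rintro u hu
    rw [(Submodule.mem_bot F).1 hu, map_zero]

end CartanDieudonne

-- The Dickson invariant through dimensions of fixed spaces.

section Parity

variable {F V : Type*} [Field F] [AddCommGroup V] [Module F V] {Q : QuadraticForm F V}

/-- The space of fixed vectors. -/
def fixed (g : V ≃ₗ[F] V) : Submodule F V := LinearMap.eqLocus g.toLinearMap LinearMap.id

theorem mem_fixed {g : V ≃ₗ[F] V} {x : V} : x ∈ fixed g ↔ g x = x := by
  simp [fixed]

theorem finrank_inf_ker [FiniteDimensional F V] (S : Submodule F V) (f : Module.Dual F V)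
    {u : V} (hu : u ∈ S) (hf : f u ≠ 0) :
    Module.finrank F S = Module.finrank F (S ⊓ LinearMap.ker f : Submodule F V) + 1 := by
  have h := LinearMap.finrank_range_add_finrank_ker (f.domRestrict S)
  have h1 : LinearMap.range (f.domRestrict S) = ⊤ :=
    LinearMap.range_eq_top.2 (LinearMap.surjective fun h0 => hf (by
      simpa using LinearMap.congr_fun h0 ⟨u, hu⟩))
  rw [h1, finrank_top, Module.finrank_self, LinearMap.ker_domRestrict,
    ← Submodule.finrank_map_subtype_eq, Submodule.map_comap_subtype] at h
  omega

/-- One of the two fixed spaces is the intersection of the other with `v⊥`, of codimension one.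
Which is the smaller depends on whether `v` lies in the image of `g - 1`, whose orthogonal
complement is `fixed g`. -/
theorem fixed_refl_mul [FiniteDimensional F V] (hB : ∀ x, (∀ y, polar Q x y = 0) → x = 0)
    {g : V ≃ₗ[F] V} (hg : g ∈ GO Q) (v : {v : V // Q v ≠ 0}) :
    Odd (Module.finrank F (fixed (refl Q v * g)) + Module.finrank F (fixed g)) := by
  have hmem : ∀ x, x ∈ fixed (refl Q v * g) ↔
      g x - x = -((Q v.1)⁻¹ * polar Q v.1 x) • v.1 := by
    intro x
    rw [mem_fixed, LinearEquiv.mul_apply]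
    have h1 : refl Q v (g x) = x ↔ g x = refl Q v x := by
      have hinv : ∀ y, refl Q v (refl Q v y) = y := fun y =>
        LinearEquiv.congr_fun (refl_mul_self Q v) y
      constructor
      · intro h
        rw [← hinv (g x), h]
      · intro h
        rw [h, hinv]
    rw [h1, refl_apply, neg_smul, sub_eq_iff_eq_add, neg_add_eq_sub]
  have hzero : ∀ x, (Q v.1)⁻¹ * polar Q v.1 x = 0 ↔ polar Q v.1 x = 0 := fun x => by
    simp [v.2]
  have hv0 : v.1 ≠ 0 := fun h => v.2 (by rw [h, map_zero])
  by_cases hv : ∃ u, g u - u = v.1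
  · obtain ⟨u, hu⟩ := hv
    have hfix : ∀ y, g y = y → polar Q v.1 y = 0 := fun y hy => by
      have := polar_GO hg u y
      rw [hy] at this
      rw [← hu, polar_sub_left, this, sub_self]
    have hQv : Q v.1 = - polar Q v.1 u := by
      rw [← hu, map_sub_eq (hg u), ← polar_neg_right, polar_comm, ← sub_eq_zero, polar_comm,
        ← polar_sub_right, sub_neg_eq_add, polar_comm, polar_add_left, polar_sub_right,
        polar_sub_right, polar_self, polar_self, hg u, polar_comm Q u]
      ring
    have hpu : polar Q v.1 u ≠ 0 := fun h => v.2 (by rw [hQv, h, neg_zero])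
    have heq : fixed (refl Q v * g) ⊓ LinearMap.ker (Q.polarBilin v.1) = fixed g := by
      ext x
      rw [Submodule.mem_inf, hmem, LinearMap.mem_ker, polarBilin_apply_apply, mem_fixed]
      constructor
      · rintro ⟨h1, h2⟩
        rw [h2, mul_zero, neg_zero, zero_smul] at h1
        exact sub_eq_zero.1 h1
      · intro h
        rw [hfix x h, h]
        simp
    have h1 : u ∈ fixed (refl Q v * g) := by
      rw [hmem, hu, ← mul_neg, ← hQv, inv_mul_cancel₀ v.2, one_smul]
    have := finrank_inf_ker (fixed (refl Q v * g)) (Q.polarBilin v.1) h1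
      (by rwa [polarBilin_apply_apply])
    rw [heq] at this
    rw [this]
    exact ⟨Module.finrank F (fixed g), by ring⟩
  · have heq : fixed g ⊓ LinearMap.ker (Q.polarBilin v.1) = fixed (refl Q v * g) := by
      ext x
      rw [Submodule.mem_inf, hmem, LinearMap.mem_ker, polarBilin_apply_apply, mem_fixed]
      constructor
      · rintro ⟨h1, h2⟩
        rw [h1, h2]
        simp
      · intro h
        have h0 : -((Q v.1)⁻¹ * polar Q v.1 x) = 0 := by
          by_contra hc
          refine hv ⟨(-((Q v.1)⁻¹ * polar Q v.1 x))⁻¹ • x, ?_⟩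
          rw [map_smul, ← smul_sub, h, smul_smul, inv_mul_cancel₀ hc, one_smul]
        rw [h0, zero_smul] at h
        exact ⟨sub_eq_zero.1 h, (hzero x).1 (neg_eq_zero.1 h0)⟩
    have hI : v.1 ∉ LinearMap.range (g.toLinearMap - LinearMap.id) := by
      rintro ⟨u, hu⟩
      exact hv ⟨u, by simpa using hu⟩
    -- A functional vanishing on the image of `g - 1` but not at `v` is represented, through the
    -- polar form, by a fixed vector outside `v⊥`.
    obtain ⟨f, hf, hfI⟩ := Submodule.exists_le_ker_of_notMem hI
    have hinj : Function.Injective Q.polarBilin := by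
      rw [injective_iff_map_eq_zero]
      intro x hx
      exact hB x fun y => by rw [← polarBilin_apply_apply, hx]; rfl
    obtain ⟨y, hy⟩ := (LinearMap.injective_iff_surjective_of_finrank_eq_finrank
      (Subspace.dual_finrank_eq (K := F) (V := V)).symm).1 hinj f
    have hyf : g y = y := by
      rw [← sub_eq_zero]
      apply hB
      intro x
      obtain ⟨z, rfl⟩ := g.surjective x
      have h4 : f (g z - z) = 0 := hfI ⟨z, by simp⟩
      rw [← hy, polarBilin_apply_apply, polar_sub_right] at h4
      rw [polar_sub_left, polar_GO hg]
      linear_combination -h4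
    have := finrank_inf_ker (fixed g) (Q.polarBilin v.1) (mem_fixed.2 hyf) (by
      rw [polarBilin_apply_apply, polar_comm, ← polarBilin_apply_apply, hy]
      exact hf)
    rw [heq] at this
    rw [this]
    exact ⟨Module.finrank F (fixed (refl Q v * g)), by ring⟩

/-- The parity of the number of factors of a product of reflections. -/
theorem even_finrank_fixed_reflProd [FiniteDimensional F V]
    (hB : ∀ x, (∀ y, polar Q x y = 0) → x = 0) (l : List {v : V // Q v ≠ 0}) :
    Even (Module.finrank F V + Module.finrank F (fixed (reflProd Q l)) + l.length) := by
  induction l with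
  | nil =>
    have : fixed (reflProd Q []) = ⊤ := by
      ext x
      simp [mem_fixed, reflProd]
    rw [this, finrank_top]
    simp
  | cons v l ih =>
    have h := fixed_refl_mul hB (reflProd_mem_GO Q l) v
    rw [← reflProd_cons] at h
    rw [List.length_cons]
    rw [Nat.odd_iff] at h
    rw [Nat.even_iff] at ih ⊢
    omega

end Parity

-- The spinor norm as the sign of a permutation.

section Spinor

variable {F V : Type*} [Field F] [AddCommGroup V] [Module F V]

/-- The permutation action of the isometries on the vectors of norm one. -/
def permSphere (Q : QuadraticForm F V) : GO Q →* Equiv.Perm {x : V // Q x = 1} where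
  toFun g := g.1.toEquiv.subtypeEquiv fun x => by
    rw [LinearEquiv.coe_toEquiv, g.2 x]
  map_one' := by ext; rfl
  map_mul' g h := by ext; rfl

variable {Q : QuadraticForm F V}

theorem polar_refl (v : {v : V // Q v ≠ 0}) (x : V) :
    polar Q v.1 (refl Q v x) = - polar Q v.1 x := by
  have := v.2
  rw [refl_apply, polar_sub_right, polar_smul_right, polar_self, nsmul_eq_mul, smul_eq_mul]
  field_simp
  push_cast
  ring

theorem exists_half_system [Finite F] (h2 : (2 : F) ≠ 0) :
    ∃ P : F → Prop, ¬ P 0 ∧ ∀ t, t ≠ 0 → (P t ↔ ¬ P (-t)) := by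
  have := Fintype.ofFinite F
  let e := Fintype.equivFin F
  refine ⟨fun t => e t < e (-t), by simp, fun t ht => ?_⟩
  have hne : e t ≠ e (-t) := fun h => by
    have h1 := e.injective h
    apply mul_ne_zero h2 ht
    linear_combination h1
  simp only [neg_neg, not_lt]
  exact ⟨le_of_lt, fun h => lt_of_le_of_ne h hne⟩

-- The involution `-refl Q v` preserves this set, so the parity is that of its fixed points. These
-- are multiples of `v` of norm one: a pair `±s • v` exists exactly when `Q v` is a square, and `P`
-- selects one of the two.
open Classical in
theorem card_halfSphere [Finite F] [Fintype V] (h2 : (2 : F) ≠ 0) (v : {v : V // Q v ≠ 0})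
    {P : F → Prop} (hP : ∀ t, t ≠ 0 → (P t ↔ ¬ P (-t))) :
    Fintype.card {x : V // Q x = 1 ∧ P (polar Q v.1 x)} % 2 = if IsSquare (Q v.1) then 1 else 0 := by
  have hinv : ∀ y, refl Q v (refl Q v y) = y := fun y =>
    LinearEquiv.congr_fun (refl_mul_self Q v) y
  let T := {x : V // Q x = 1 ∧ P (polar Q v.1 x)}
  let f : Function.End T := fun x => ⟨- refl Q v x.1, by
    rw [QuadraticMap.map_neg, refl_mem_GO Q v, polar_neg_right, polar_refl, neg_neg]
    exact x.2⟩
  have hf : f ^ 2 ^ 1 = 1 := by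
    funext x
    apply Subtype.ext
    change - refl Q v (- refl Q v x.1) = x.1
    rw [map_neg, neg_neg, hinv]
  have hcard := Equiv.Perm.card_fixedPoints_modEq hf
  have hspan : ∀ x : T, f x = x → ∃ s : F, x.1 = s • v.1 := by
    intro x hx
    have h1 : - refl Q v x.1 = x.1 := congrArg Subtype.val hx
    rw [refl_apply] at h1
    refine ⟨2⁻¹ * ((Q v.1)⁻¹ * polar Q v.1 x.1), ?_⟩
    rw [mul_smul]
    have h3 : ((Q v.1)⁻¹ * polar Q v.1 x.1) • v.1 = (2 : F) • x.1 := by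
      rw [two_smul]
      nth_rewrite 2 [← h1]
      abel
    rw [h3, smul_smul, inv_mul_cancel₀ h2, one_smul]
  have hpv : polar Q v.1 v.1 ≠ 0 := by
    rw [polar_self, nsmul_eq_mul]
    exact mul_ne_zero (by exact_mod_cast h2) v.2
  change Fintype.card T % 2 = _
  rw [hcard]
  split_ifs with hs
  · obtain ⟨b, hb⟩ := hs
    have hb0 : b ≠ 0 := fun h => v.2 (by rw [hb, h, zero_mul])
    have hone : ∀ c, c * c = b * b → Q (c⁻¹ • v.1) = 1 := fun c hc => by
      rw [QuadraticMap.map_smul, hb, ← hc, smul_eq_mul]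
      have : c ≠ 0 := fun h => by
        rw [h, zero_mul] at hc
        exact mul_ne_zero hb0 hb0 hc.symm
      field_simp
    have hx0 : ∃ c, c * c = b * b ∧ P (polar Q v.1 (c⁻¹ • v.1)) := by
      by_cases h : P (polar Q v.1 (b⁻¹ • v.1))
      · exact ⟨b, rfl, h⟩
      · refine ⟨-b, by ring, ?_⟩
        by_contra hc
        apply h
        rw [hP]
        · convert hc using 2
          rw [inv_neg, neg_smul, polar_neg_right]
        · rw [polar_smul_right]
          exact mul_ne_zero (inv_ne_zero hb0) hpv
    obtain ⟨c, hc, hPc⟩ := hx0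
    have hc0 : c ≠ 0 := fun h => by
      rw [h, zero_mul] at hc
      exact mul_ne_zero hb0 hb0 hc.symm
    have h1 : Fintype.card (Function.fixedPoints f) = 1 := by
      rw [Fintype.card_eq_one_iff]
      refine ⟨⟨⟨c⁻¹ • v.1, hone c hc, hPc⟩, ?_⟩, ?_⟩
      · apply Subtype.ext
        change - refl Q v (c⁻¹ • v.1) = c⁻¹ • v.1
        have : refl Q v v.1 = - v.1 := by
          have hv := v.2
          rw [refl_apply, polar_self, nsmul_eq_mul, mul_left_comm, inv_mul_cancel₀ hv]
          push_cast
          module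
        rw [map_smul, this, smul_neg, neg_neg]
      · rintro ⟨x, hx⟩
        obtain ⟨s, hsx⟩ := hspan x hx
        have h3 : (s * c) * (s * c) = 1 := by
          have := x.2.1
          rw [hsx, QuadraticMap.map_smul, hb, ← hc, smul_eq_mul] at this
          linear_combination this
        have h4 : s = c⁻¹ ∨ s = -c⁻¹ := by
          rcases mul_self_eq_one_iff.1 h3 with h | h
          · left
            field_simp
            exact h
          · right
            field_simp
            exact h
        apply Subtype.ext
        apply Subtype.ext
        change x.1 = c⁻¹ • v.1
        rcases h4 with h | h
        · rw [hsx, h]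
        · exfalso
          have hPx := x.2.2
          rw [hsx, h, neg_smul, polar_neg_right] at hPx
          refine (hP _ ?_).1 hPc hPx
          rw [polar_smul_right]
          exact mul_ne_zero (inv_ne_zero hc0) hpv
    rw [h1]
  · have h1 : Fintype.card (Function.fixedPoints f) = 0 := by
      rw [Fintype.card_eq_zero_iff]
      refine ⟨fun ⟨x, hx⟩ => hs ?_⟩
      obtain ⟨s, hsx⟩ := hspan x hx
      have := x.2.1
      rw [hsx, QuadraticMap.map_smul, smul_eq_mul] at this
      have hs0 : s ≠ 0 := fun h => by simp [h] at this
      exact ⟨s⁻¹, by field_simp; linear_combination this⟩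
    rw [h1]

-- The reflection is an involution whose 2-cycles `{x, refl Q v x}` have opposite nonzero pairings
-- with `v`. The half system `P` counts each cycle once, and the preceding count gives the parity.
open Classical in
theorem sign_permSphere_refl [Fintype F] [Fintype V] (h2 : (2 : F) ≠ 0)
    (v : {v : V // Q v ≠ 0}) :
    ((Equiv.Perm.sign (permSphere Q ⟨refl Q v, refl_mem_GO Q v⟩) : ℤˣ) : ℤ) =
      - quadraticChar F (Q v.1) := by
  obtain ⟨P, hP0, hP⟩ := exists_half_system h2
  let σ := permSphere Q ⟨refl Q v, refl_mem_GO Q v⟩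
  have hinv : ∀ y, refl Q v (refl Q v y) = y := fun y =>
    LinearEquiv.congr_fun (refl_mul_self Q v) y
  have hσ : σ ^ 2 = 1 := by
    ext x
    change refl Q v (refl Q v x.1) = x.1
    exact hinv _
  have hv0 : v.1 ≠ 0 := fun h => v.2 (by rw [h, map_zero])
  let T : Finset {x : V // Q x = 1} := Finset.univ.filter fun x => P (polar Q v.1 x.1)
  let T' : Finset {x : V // Q x = 1} := Finset.univ.filter fun x => P (- polar Q v.1 x.1)
  let T₀ : Finset {x : V // Q x = 1} := Finset.univ.filter fun x => polar Q v.1 x.1 = 0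
  have hTT' : T.card = T'.card := by
    refine Finset.card_equiv σ fun x => ?_
    simp only [T, T', Finset.mem_filter, Finset.mem_univ, true_and]
    change _ ↔ P (- polar Q v.1 (refl Q v x.1))
    rw [polar_refl, neg_neg]
  have hfix : Fintype.card (Function.fixedPoints σ) = T₀.card := by
    rw [Fintype.card_subtype]
    congr 1
    ext x
    simp only [T₀, Finset.mem_filter, Finset.mem_univ, true_and, Function.mem_fixedPoints,
      Function.IsFixedPt]
    rw [Subtype.ext_iff]
    change refl Q v x.1 = x.1 ↔ _
    rw [refl_apply, sub_eq_self, smul_eq_zero_iff_left hv0, mul_eq_zero_iff_left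
      (inv_ne_zero v.2)]
  have hcard : Fintype.card {x : V // Q x = 1} = T₀.card + T.card + T'.card := by
    rw [← Finset.card_univ, ← Finset.card_union_of_disjoint, ← Finset.card_union_of_disjoint]
    · congr 1
      ext x
      simp only [T, T', T₀, Finset.mem_union, Finset.mem_filter, Finset.mem_univ, true_and,
        true_iff]
      by_cases h : polar Q v.1 x.1 = 0
      · exact Or.inl (Or.inl h)
      · by_cases h' : P (polar Q v.1 x.1)
        · exact Or.inl (Or.inr h')
        · right
          by_contra hc
          exact h' ((hP _ h).2 hc)
    · rw [Finset.disjoint_left]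
      intro x hx hx'
      simp only [T, T', T₀, Finset.mem_union, Finset.mem_filter, Finset.mem_univ, true_and]
        at hx hx'
      rcases hx with hx | hx
      · rw [hx, neg_zero] at hx'
        exact hP0 hx'
      · refine (hP _ fun h => ?_).1 hx hx'
        rw [h] at hx
        exact hP0 hx
    · rw [Finset.disjoint_left]
      intro x hx hx'
      simp only [T, T₀, Finset.mem_filter, Finset.mem_univ, true_and] at hx hx'
      rw [hx] at hx'
      exact hP0 hx'
  have hT : T.card % 2 = if IsSquare (Q v.1) then 1 else 0 := by
    refine Eq.trans ?_ ((card_halfSphere h2 v hP).trans (by congr))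
    congr 1
    rw [← Fintype.card_coe]
    refine Fintype.card_congr ((Equiv.subtypeEquivRight fun x => ?_).trans
      (Equiv.subtypeSubtypeEquivSubtypeInter (fun x : V => Q x = 1)
        (fun x => P (polar Q v.1 x))))
    simp [T]
  rw [Equiv.Perm.sign_of_pow_two_eq_one hσ, hfix, hcard, ← hTT']
  have : (T₀.card + T.card + T.card - T₀.card) / 2 = T.card := by omega
  rw [this, ← Nat.div_add_mod T.card 2, hT, pow_add, pow_mul]
  split_ifs with hs
  · rw [(quadraticChar_one_iff_isSquare v.2).2 hs]
    simp
  · rw [quadraticChar_neg_one_iff_not_isSquare.2 hs]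
    simp

open Classical in
theorem sign_permSphere_reflProd [Fintype F] [Fintype V] (h2 : (2 : F) ≠ 0)
    (l : List {v : V // Q v ≠ 0}) :
    ((Equiv.Perm.sign (permSphere Q ⟨reflProd Q l, reflProd_mem_GO Q l⟩) : ℤˣ) : ℤ) =
      (-1) ^ l.length * quadraticChar F (spinorProd Q l) := by
  induction l with
  | nil =>
    have : (⟨reflProd Q [], reflProd_mem_GO Q []⟩ : GO Q) = 1 := rfl
    rw [this]
    simp [spinorProd]
  | cons v l ih =>
    have h1 : (⟨reflProd Q (v :: l), reflProd_mem_GO Q (v :: l)⟩ : GO Q) =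
        ⟨refl Q v, refl_mem_GO Q v⟩ * ⟨reflProd Q l, reflProd_mem_GO Q l⟩ :=
      Subtype.ext (reflProd_cons Q v l)
    have h3 : spinorProd Q (v :: l) = Q v.1 * spinorProd Q l := by simp [spinorProd]
    rw [h1, map_mul, map_mul, Units.val_mul, ih, sign_permSphere_refl h2, h3, map_mul,
      List.length_cons]
    ring

/-- The spinor norm of a product of an even number of reflections is well defined. -/
theorem isSquare_spinorProd_iff [Finite F] [Finite V] {l l' : List {v : V // Q v ≠ 0}}
    (hl : Even l.length) (hl' : Even l'.length) (h : reflProd Q l = reflProd Q l') :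
    IsSquare (spinorProd Q l) ↔ IsSquare (spinorProd Q l') := by
  classical
  have := Fintype.ofFinite F
  have := Fintype.ofFinite V
  by_cases h2 : (2 : F) = 0
  · have hc : CharP F 2 := CharTwo.of_one_ne_zero_of_two_eq_zero one_ne_zero h2
    have : ringChar F = 2 := ringChar.eq F 2 ▸ rfl
    exact ⟨fun _ => FiniteField.isSquare_of_char_two this _,
      fun _ => FiniteField.isSquare_of_char_two this _⟩
  · have h1 := sign_permSphere_reflProd h2 l
    have h3 := sign_permSphere_reflProd h2 l'
    simp only [h] at h1
    rw [h1, hl.neg_one_pow, hl'.neg_one_pow, one_mul, one_mul] at h3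
    rw [← quadraticChar_one_iff_isSquare (spinorProd_ne_zero Q l), h3,
      quadraticChar_one_iff_isSquare (spinorProd_ne_zero Q l')]

end Spinor

-- The stabilizer of a nonsingular vector.

section Stabilizer

variable {F V : Type*} [Field F] [AddCommGroup V] [Module F V] {Q : QuadraticForm F V}

/-- The orthogonal complement of a vector. -/
def perp (Q : QuadraticForm F V) (w : V) : Submodule F V := LinearMap.ker (Q.polarBilin w)

theorem mem_perp {w x : V} : x ∈ perp Q w ↔ polar Q w x = 0 := by
  simp [perp]

/-- The restriction of a quadratic form to the orthogonal complement of a vector. -/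
abbrev perpForm (Q : QuadraticForm F V) (w : V) : QuadraticForm F (perp Q w) :=
  Q.comp (perp Q w).subtype

theorem exists_smul_of_perp_le (hB : ∀ x, (∀ y, polar Q x y = 0) → x = 0) {w x : V}
    (h : ∀ y ∈ perp Q w, polar Q x y = 0) : ∃ c : F, x = c • w := by
  by_cases hw : ∀ y, polar Q w y = 0
  · refine ⟨0, ?_⟩
    rw [zero_smul]
    exact hB x fun y => h y (mem_perp.2 (hw y))
  · push Not at hw
    obtain ⟨y₀, hy₀⟩ := hw
    refine ⟨polar Q x y₀ / polar Q w y₀, ?_⟩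
    rw [← sub_eq_zero]
    apply hB
    intro y
    have h1 := h (y - (polar Q w y / polar Q w y₀) • y₀) (by
      rw [mem_perp, polar_sub_right, polar_smul_right, smul_eq_mul]
      field_simp
      ring)
    rw [polar_sub_right, polar_smul_right, smul_eq_mul] at h1
    rw [polar_sub_left, polar_smul_left, smul_eq_mul]
    rw [← h1]
    field_simp

/-- The radical of `w⊥` lies in the line of `w`, where `Q` has no nonzero zero. In characteristic
two that line really is the radical, so `Nondeg` cannot be strengthened to a nondegenerate polar
form. -/
theorem nondeg_perpForm (hB : ∀ x, (∀ y, polar Q x y = 0) → x = 0) {w : V} (hw : Q w ≠ 0) :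
    Nondeg (perpForm Q w) := by
  intro x hx hQx
  obtain ⟨c, hc⟩ := exists_smul_of_perp_le (x := x.1) (w := w) hB fun y hy => by
    rw [← hx ⟨y, hy⟩, polar_restrict]
  have h0 : Q x.1 = 0 := hQx
  rw [hc, QuadraticMap.map_smul, smul_eq_mul] at h0
  have : c = 0 := by simpa [hw] using h0
  exact Subtype.ext (by rw [hc, this, zero_smul]; rfl)

theorem finrank_perp [FiniteDimensional F V] (hB : ∀ x, (∀ y, polar Q x y = 0) → x = 0) {w : V}
    (hw : Q w ≠ 0) : Module.finrank F V = Module.finrank F (perp Q w) + 1 := by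
  obtain ⟨u, hu⟩ : ∃ u, polar Q w u ≠ 0 := by
    by_contra! hc
    exact hw (by rw [hB w hc, map_zero])
  have := finrank_inf_ker ⊤ (Q.polarBilin w) (Submodule.mem_top (x := u)) hu
  rwa [finrank_top, top_inf_eq] at this

theorem perp_subtype_similitude (w : V) (x : perp Q w) :
    Q ((perp Q w).subtype x) = 1 * perpForm Q w x := by
  rw [one_mul]
  rfl

theorem apply_mem_perp {w : V} {g : V ≃ₗ[F] V} (hg : g ∈ GO Q) (hw : g w = w) {x : V}
    (hx : x ∈ perp Q w) : g x ∈ perp Q w := by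
  have := polar_GO hg w x
  rw [hw, mem_perp.1 hx] at this
  exact mem_perp.2 this

theorem stabilizer_apply {w : V} (g : MulAction.stabilizer (Omega Q) w) : g.1.1 w = w :=
  MulAction.mem_stabilizer_iff.1 g.2

/-- The restriction of the elements of the stabilizer of a vector to its orthogonal complement. -/
def restrictPerp (Q : QuadraticForm F V) (w : V) :
    MulAction.stabilizer (Omega Q) w →* (perp Q w ≃ₗ[F] perp Q w) where
  toFun g :=
    { toFun := fun x => ⟨g.1.1 x.1,
        apply_mem_perp (Omega_le_GO Q g.1.2) (stabilizer_apply g) x.2⟩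
      invFun := fun x => ⟨g⁻¹.1.1 x.1,
        apply_mem_perp (Omega_le_GO Q g⁻¹.1.2) (stabilizer_apply g⁻¹) x.2⟩
      map_add' := fun x y => Subtype.ext (map_add g.1.1 x.1 y.1)
      map_smul' := fun c x => Subtype.ext (map_smul g.1.1 c x.1)
      left_inv := fun x => Subtype.ext (g.1.1.symm_apply_apply x.1)
      right_inv := fun x => Subtype.ext (g.1.1.apply_symm_apply x.1) }
  map_one' := rfl
  map_mul' _ _ := rfl

theorem restrictPerp_apply (w : V) (g : MulAction.stabilizer (Omega Q) w) (x : perp Q w) :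
    (restrictPerp Q w g x : V) = g.1.1 x.1 := rfl

/-- An element of the kernel fixes the hyperplane `w⊥`. Being a product of an even number of
reflections, it has a fixed space of even codimension, so it cannot stop at codimension one. -/
theorem restrictPerp_injective [FiniteDimensional F V]
    (hB : ∀ x, (∀ y, polar Q x y = 0) → x = 0) {w : V} (hw : Q w ≠ 0)
    (hV : Even (Module.finrank F V)) : Function.Injective (restrictPerp Q w) := by
  rw [injective_iff_map_eq_one]
  intro g hg
  have hle : perp Q w ≤ fixed g.1.1 := fun x hx => by
    have := LinearEquiv.congr_fun hg ⟨x, hx⟩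
    exact mem_fixed.2 (congrArg Subtype.val this)
  obtain ⟨l, hl, -, hlg⟩ := g.1.2
  have h1 := even_finrank_fixed_reflProd hB l
  rw [hlg] at h1
  have h2 := Submodule.finrank_mono hle
  have h3 := Submodule.finrank_le (fixed g.1.1)
  have h4 := finrank_perp hB hw
  have h5 : Module.finrank F (fixed g.1.1) = Module.finrank F V := by
    rw [Nat.even_iff] at h1 hl hV
    omega
  have h6 := Submodule.eq_top_of_finrank_eq h5
  apply Subtype.ext
  apply Subtype.ext
  ext x
  exact mem_fixed.1 (h6 ▸ Submodule.mem_top : x ∈ fixed g.1.1)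

/-- Reflections of `w⊥` extend to reflections of `V` fixing `w`, which gives one inclusion. For the
other, the restriction is a product of reflections of `w⊥`; parity and spinor norm have to be
transferred from `V`. -/
theorem range_restrictPerp [Finite F] [FiniteDimensional F V]
    (hB : ∀ x, (∀ y, polar Q x y = 0) → x = 0) {w : V} (hw : Q w ≠ 0) {n : ℕ}
    (hV : Module.finrank F V = 2 * n + 2) :
    (restrictPerp Q w).range = Omega (perpForm Q w) := by
  have hlift := fun l x => reflProd_mapVec (φ := (perp Q w).subtype) one_ne_zero
    (perp_subtype_similitude (Q := Q) w) l x
  have hfixw : ∀ l : List {v // perpForm Q w v ≠ 0},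
      reflProd Q (l.map (mapVec one_ne_zero (perp_subtype_similitude w))) w = w := by
    intro l
    induction l with
    | nil => rfl
    | cons v l ih =>
      rw [List.map_cons, reflProd_cons, LinearEquiv.mul_apply, ih]
      apply refl_apply_of_polar_eq_zero
      rw [polar_comm]
      exact mem_perp.1 v.1.2
  have hspin := fun l => spinorProd_mapVec (φ := (perp Q w).subtype) one_ne_zero
    (perp_subtype_similitude (Q := Q) w) l
  have hrange : ∀ (l : List {v // perpForm Q w v ≠ 0}) (h : reflProd Q
      (l.map (mapVec one_ne_zero (perp_subtype_similitude w))) ∈ Omega Q),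
      restrictPerp Q w ⟨⟨_, h⟩, hfixw l⟩ = reflProd (perpForm Q w) l := by
    intro l h
    ext x
    exact hlift l x
  apply le_antisymm
  · rintro _ ⟨g, rfl⟩
    have hGO : restrictPerp Q w g ∈ GO (perpForm Q w) := fun x => Omega_le_GO Q g.1.2 x.1
    have hodd : Module.finrank F (perp Q w) = 2 * n + 1 := by
      have := finrank_perp hB hw
      omega
    obtain ⟨l, hl⟩ := (nondeg_perpForm hB hw).exists_reflProd hodd hGO
    have : Finite V := Module.finite_of_finite F
    obtain ⟨l', hl', hs', hg'⟩ := g.1.2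
    by_cases h2 : (2 : F) = 0
    · have hc : CharP F 2 := CharTwo.of_one_ne_zero_of_two_eq_zero one_ne_zero h2
      have hc' : ringChar F = 2 := ringChar.eq F 2 ▸ rfl
      rcases Nat.even_or_odd l.length with he | ho
      · exact ⟨l, he, FiniteField.isSquare_of_char_two hc' _, hl⟩
      -- Here `w` is radical in `w⊥`, so its reflection there is the identity and can be inserted to
      -- correct the parity.
      · have hww : w ∈ perp Q w := by
          rw [mem_perp, polar_self, nsmul_eq_mul]
          simp [h2]
        refine ⟨⟨⟨w, hww⟩, hw⟩ :: l, ?_, FiniteField.isSquare_of_char_two hc' _, ?_⟩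
        · rw [List.length_cons]
          exact ho.add_one
        · rw [reflProd_cons, hl]
          ext x
          rw [LinearEquiv.mul_apply, refl_apply_of_polar_eq_zero]
          rw [polar_restrict]
          exact mem_perp.1 (restrictPerp Q w g x).2
    -- Now `V` is the sum of `w⊥` and the line of `w`, so the extended product is `g` itself and the
    -- two invariants can be compared in `V`.
    · have hgl : reflProd Q (l.map (mapVec one_ne_zero (perp_subtype_similitude w))) = g.1.1 := by
        ext x
        have hww : polar Q w w ≠ 0 := by
          rw [polar_self, nsmul_eq_mul]
          exact mul_ne_zero (by exact_mod_cast h2) hw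
        have hx : x - (polar Q w x / polar Q w w) • w ∈ perp Q w := by
          rw [mem_perp, polar_sub_right, polar_smul_right, smul_eq_mul]
          field_simp
          ring
        have h3 := hlift l ⟨_, hx⟩
        rw [hl] at h3
        simp only [Submodule.subtype_apply, restrictPerp_apply, map_sub, map_smul, hfixw,
          stabilizer_apply] at h3
        exact sub_left_injective h3
      have he : Even l.length := by
        have h3 := even_finrank_fixed_reflProd hB
          (l.map (mapVec one_ne_zero (perp_subtype_similitude w)))
        have h4 := even_finrank_fixed_reflProd hB l'
        rw [hgl, List.length_map] at h3
        rw [hg'] at h4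
        rw [Nat.even_iff] at h3 h4 hl' ⊢
        omega
      refine ⟨l, he, ?_, hl⟩
      have h5 := (isSquare_spinorProd_iff (by rwa [List.length_map]) hl' (hgl.trans hg'.symm)).2 hs'
      rwa [hspin, one_pow, one_mul] at h5
  · rintro _ ⟨l, hl, hs, rfl⟩
    have hmem : reflProd Q (l.map (mapVec one_ne_zero (perp_subtype_similitude w))) ∈ Omega Q :=
      ⟨_, by rwa [List.length_map], by rwa [hspin, one_pow, one_mul], rfl⟩
    exact ⟨_, hrange l hmem⟩

/-- The stabilizer of a nonsingular vector is embedded in the projective group. -/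
def stabEquiv {w : V} (hw : Q w ≠ 0) : MulAction.stabilizer (Omega Q) w ≃* stab Q w :=
  (MonoidHom.ofInjective (f := (QuotientGroup.mk' (scalars Q)).comp
    (MulAction.stabilizer (Omega Q) w).subtype) (by
      rw [injective_iff_map_eq_one]
      intro g hg
      have h1 : g.1 ∈ scalars Q := (QuotientGroup.eq_one_iff g.1).1 hg
      obtain ⟨c, hc⟩ := h1
      have hw0 : w ≠ 0 := fun h => hw (by rw [h, map_zero])
      have h2 : c • w = (1 : F) • w := by rw [← hc, stabilizer_apply, one_smul]
      have h3 : c = 1 := smul_left_injective F hw0 h2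
      apply Subtype.ext
      apply Subtype.ext
      ext x
      rw [hc, h3, one_smul]
      rfl)).trans (MulEquiv.subgroupCongr (by
        rw [MonoidHom.range_comp, Subgroup.range_subtype]
        rfl))

theorem nonempty_stab_equiv [Finite F] [FiniteDimensional F V]
    (hB : ∀ x, (∀ y, polar Q x y = 0) → x = 0) {w : V} (hw : Q w ≠ 0) {n : ℕ}
    (hV : Module.finrank F V = 2 * n + 2) :
    Nonempty (stab Q w ≃* Omega (oddForm F n)) := by
  obtain ⟨a, ha, φ, hφ⟩ := (nondeg_perpForm hB hw).exists_similitude (n := n) (by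
    have := finrank_perp hB hw
    omega)
  exact ⟨((stabEquiv hw).symm.trans (MonoidHom.ofInjective (restrictPerp_injective hB hw
    ⟨n + 1, by omega⟩))).trans ((MulEquiv.subgroupCongr (range_restrictPerp hB hw hV)).trans
      (OmegaCongr ha φ hφ))⟩

/-- A product of two reflections in vectors of norm one lies in `Ω`. The vectors are chosen so that
one reflection fixes `w` and the other moves `w` off its line, which no scalar multiple of a
stabilizing element does. -/
theorem stab_ne_top [Finite F] [FiniteDimensional F V]
    (hB : ∀ x, (∀ y, polar Q x y = 0) → x = 0) {w : V} (hw : Q w ≠ 0)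
    (hV : 4 ≤ Module.finrank F V) : stab Q w ≠ ⊤ := by
  have hW := finrank_perp hB hw
  obtain ⟨e, he0, he⟩ := exists_isotropic (perpForm Q w) (by omega)
  obtain ⟨f, hf, hef⟩ := (nondeg_perpForm hB hw).exists_hyperbolic he0 he
  rw [polar_restrict] at hef
  change Q e.1 = 0 at he
  change Q f.1 = 0 at hf
  have hwe := mem_perp.1 e.2
  have hwf := mem_perp.1 f.2
  obtain ⟨x, hx⟩ : ∃ x, polar Q w x ≠ 0 := by
    by_contra! hc
    exact hw (by rw [hB w hc, map_zero])
  let y := (pairProj Q he hf hef x : V)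
  have hy := mem_pairPerp.1 (pairProj Q he hf hef x).2
  have hye : polar Q y e.1 = 0 := by rw [polar_comm]; exact hy.1
  have hyf : polar Q y f.1 = 0 := by rw [polar_comm]; exact hy.2
  have hwy : polar Q w y ≠ 0 := by
    rw [pairProj_eq he hf hef x, polar_add_right, polar_add_right, polar_smul_right,
      polar_smul_right, hwe, hwf] at hx
    simpa using hx
  -- The hyperbolic pair `e, f` in `w⊥` adjusts the norm to 1 without changing the pairing with `w`;
  -- the coefficient of `e` gives pairing 1 with `f`.
  let v := y + (e.1 + (1 - Q y) • f.1)
  have hee : polar Q f.1 f.1 = 0 := by rw [polar_self, hf, smul_zero]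
  have hQv : Q v = 1 := by
    simp only [v]
    rw [QuadraticMap.map_add Q, QuadraticMap.map_add Q, QuadraticMap.map_smul, polar_add_right,
      polar_smul_right, polar_smul_right, he, hf, hef, hye, hyf]
    simp
  have hwv : polar Q w v ≠ 0 := by
    simp only [v]
    rw [polar_add_right, polar_add_right, polar_smul_right, hwe, hwf]
    simpa using hwy
  have hvf : polar Q v f.1 = 1 := by
    simp only [v]
    rw [polar_add_left, polar_add_left, polar_smul_left, hyf, hef, hee]
    simp
  have hQv' : Q (e.1 + f.1) = 1 := by
    rw [QuadraticMap.map_add Q, he, hf, hef]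
    simp
  let a : {v : V // Q v ≠ 0} := ⟨v, by rw [hQv]; exact one_ne_zero⟩
  let b : {v : V // Q v ≠ 0} := ⟨e.1 + f.1, by rw [hQv']; exact one_ne_zero⟩
  have hmem : reflProd Q [a, b] ∈ Omega Q :=
    ⟨[a, b], by simp, by simp [spinorProd, a, b, hQv, hQv'], rfl⟩
  intro htop
  have h1 : QuotientGroup.mk' (scalars Q) ⟨_, hmem⟩ ∈ stab Q w := htop ▸ Subgroup.mem_top _
  obtain ⟨g, hg, hgeq⟩ := h1
  have hgw : g.1 w = w := MulAction.mem_stabilizer_iff.1 hg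
  obtain ⟨c, hc⟩ := (QuotientGroup.eq (s := scalars Q)).1 hgeq
  have h2 : reflProd Q [a, b] w = c • w := by
    have h3 := hc w
    change g.1.symm (reflProd Q [a, b] w) = c • w at h3
    rw [LinearEquiv.symm_apply_eq] at h3
    rw [h3, map_smul, hgw]
  have h4 : reflProd Q [a, b] w = w - polar Q v w • v := by
    have : reflProd Q [a, b] = refl Q a * refl Q b := by simp [reflProd]
    rw [this, LinearEquiv.mul_apply, refl_apply_of_polar_eq_zero b, refl_apply]
    · simp only [a, hQv, inv_one, one_mul]
    · simp only [b]
      rw [polar_comm, polar_add_right, hwe, hwf, add_zero]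
  have h5 : polar Q (w - polar Q v w • v) f.1 = polar Q (c • w) f.1 := by rw [← h4, h2]
  rw [polar_sub_left, polar_smul_left, polar_smul_left, hwf, hvf, polar_comm Q v w] at h5
  apply hwv
  simpa using h5

end Stabilizer

-- Semisimple element orders realized in the odd-dimensional group.

section Orders

variable {F W W₁ W₂ : Type*} [Field F] [AddCommGroup W] [Module F W] {Q : QuadraticForm F W}
  [AddCommGroup W₁] [Module F W₁] [AddCommGroup W₂] [Module F W₂]

/-- A quadratic form is regular if its polar form is nondegenerate. -/
def Regular (Q : QuadraticForm F W) : Prop := ∀ x, (∀ y, polar Q x y = 0) → x = 0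

theorem Nondeg.prod {Q₁ : QuadraticForm F W₁} {Q₂ : QuadraticForm F W₂} (h₁ : Nondeg Q₁)
    (h₂ : Regular Q₂) : Nondeg (Q₁.prod Q₂) := by
  rintro ⟨a, b⟩ h hQ
  have hb : b = 0 := h₂ b fun y => by
    have := h (0, y)
    rwa [polar_prod, polar_zero_right, zero_add] at this
  have ha : a = 0 := by
    apply h₁
    · intro y
      have := h (y, 0)
      rwa [polar_prod, polar_zero_right, add_zero] at this
    · rw [prod_apply, hb, map_zero, add_zero] at hQ
      exact hQ
  rw [ha, hb]
  rfl

theorem nondeg_sq : Nondeg (QuadraticMap.sq : QuadraticForm F F) := by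
  intro x _ hx
  simpa using hx

theorem regular_plusForm (n : ℕ) : Regular (plusForm F n) := by
  classical
  rintro ⟨x, y⟩ h
  have hp : ∀ p : (Fin n → F) × (Fin n → F), polar (plusForm F n) (x, y) p =
      ∑ i, (x i * p.2 i + p.1 i * y i) := fun p => by
    simp only [polar, plusForm_apply, ← Finset.sum_sub_distrib]
    refine Finset.sum_congr rfl fun i _ => ?_
    simp
    ring
  refine Prod.ext (funext fun i => ?_) (funext fun i => ?_)
  · have := h (0, Pi.single i 1)
    rw [hp] at this
    simpa [Pi.single_apply] using this
  · have := h (Pi.single i 1, 0)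
    rw [hp] at this
    simpa [Pi.single_apply] using this

theorem nondeg_oddForm (n : ℕ) : Nondeg (oddForm F n) :=
  nondeg_sq.prod (regular_plusForm n)

theorem regular_dualProd [FiniteDimensional F W] : Regular (QuadraticForm.dualProd F W) := by
  rintro ⟨f, x⟩ h
  have hp : ∀ p, polar (QuadraticForm.dualProd F W) (f, x) p = f p.2 + p.1 x := fun p => by
    simp [polar]
    ring
  refine Prod.ext (LinearMap.ext fun y => ?_) ?_
  · have := h (0, y)
    rw [hp] at this
    simpa using this
  · refine (Module.forall_dual_apply_eq_zero_iff F x).1 fun g => ?_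
    have := h (g, 0)
    rw [hp] at this
    simpa using this

theorem refl_inl_mul {Q₁ : QuadraticForm F W₁} {Q₂ : QuadraticForm F W₂} {u : W₁}
    (hu : Q₁.prod Q₂ (u, 0) ≠ 0) (x : W₂) : refl (Q₁.prod Q₂) ⟨(u, 0), hu⟩ (0, x) = (0, x) := by
  apply refl_apply_of_polar_eq_zero
  rw [polar_prod, polar_zero_right, polar_zero_left, add_zero]

theorem oddForm_universal {n : ℕ} (hn : 0 < n) (c : F) : ∃ u, oddForm F n u = c := by
  classical
  refine ⟨(0, Pi.single ⟨0, hn⟩ c, Pi.single ⟨0, hn⟩ 1), ?_⟩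
  rw [oddForm_apply]
  simp [Pi.single_apply]

theorem orderOf_prodCongr_refl (g : W₂ ≃ₗ[F] W₂) :
    orderOf ((LinearEquiv.refl F W₁).prodCongr g) = orderOf g := by
  have hpow : ∀ k, ((LinearEquiv.refl F W₁).prodCongr g) ^ k =
      (LinearEquiv.refl F W₁).prodCongr (g ^ k) := by
    intro k
    induction k with
    | zero => rfl
    | succ k ih => rw [pow_succ, ih, pow_succ]; rfl
  rw [orderOf_eq_orderOf_iff]
  intro k
  rw [hpow]
  constructor
  · intro h
    ext x
    exact congrArg Prod.snd (LinearEquiv.congr_fun h (0, x))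
  · intro h
    rw [h]
    rfl

/-- Multiplication by a unit of an extension field. -/
def mulUnit (F : Type*) [Field F] {K : Type*} [Field K] [Algebra F K] : Kˣ →* (K ≃ₗ[F] K) :=
  DistribMulAction.toModuleAut F K

theorem mulUnit_apply {K : Type*} [Field K] [Algebra F K] (ζ : Kˣ) (x : K) :
    mulUnit F ζ x = ζ * x := rfl

theorem mulUnit_injective {K : Type*} [Field K] [Algebra F K] :
    Function.Injective (mulUnit F (K := K)) := by
  intro a b h
  have := LinearEquiv.congr_fun h 1
  rw [mulUnit_apply, mulUnit_apply, mul_one, mul_one] at this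
  exact Units.ext this

variable [Finite F]

theorem dvd_exponent_of_mem_Omega [FiniteDimensional F W] (hQ : Nondeg Q) {n : ℕ}
    (h : Module.finrank F W = 2 * n + 1) {g : W ≃ₗ[F] W} (hg : g ∈ Omega Q) :
    orderOf g ∣ Monoid.exponent (Omega (oddForm F n)) := by
  obtain ⟨a, ha, φ, hφ⟩ := hQ.exists_similitude h
  rw [← Monoid.exponent_eq_of_mulEquiv (OmegaCongr ha φ hφ), ← Subgroup.orderOf_mk g hg]
  exact Monoid.order_dvd_exponent _

/-- An element of odd order is a power of its square, and squares of products of reflections lie in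
`Ω`. In characteristic two spinor norms are trivial, and a radical vector, whose reflection is the
identity, corrects the parity. -/
theorem dvd_exponent_of_mem_GO [FiniteDimensional F W] (hQ : Nondeg Q) {n : ℕ}
    (h : Module.finrank F W = 2 * n + 1) {g : W ≃ₗ[F] W} (hg : g ∈ GO Q)
    (hodd : Odd (orderOf g) ∨ (2 : F) = 0) :
    orderOf g ∣ Monoid.exponent (Omega (oddForm F n)) := by
  apply dvd_exponent_of_mem_Omega hQ h
  obtain ⟨l, hl⟩ := hQ.exists_reflProd h hg
  rcases hodd with ⟨k, hk⟩ | h2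
  · have h1 : g = (g ^ 2) ^ (k + 1) := by
      rw [← pow_mul, show 2 * (k + 1) = orderOf g + 1 by rw [hk]; ring, pow_succ,
        pow_orderOf_eq_one, one_mul]
    rw [h1, ← hl]
    exact pow_mem (sq_mem_Omega Q l) _
  · have hc : CharP F 2 := CharTwo.of_one_ne_zero_of_two_eq_zero one_ne_zero h2
    have hc' : ringChar F = 2 := ringChar.eq F 2 ▸ rfl
    rcases Nat.even_or_odd l.length with he | ho
    · exact ⟨l, he, FiniteField.isSquare_of_char_two hc' _, hl⟩
    · obtain ⟨w, hw, hr⟩ := hQ.exists_radical h h2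
      refine ⟨⟨w, hw⟩ :: l, ?_, FiniteField.isSquare_of_char_two hc' _, ?_⟩
      · rw [List.length_cons]
        exact ho.add_one
      · rw [reflProd_cons, hl]
        ext x
        rw [LinearEquiv.mul_apply, refl_apply_of_polar_eq_zero]
        exact hr _

/-- The order of an isometry acting on a complement of a subspace on which the form is universal
divides the exponent of `Ω`. -/
theorem dvd_exponent_of_universal [FiniteDimensional F W₁] [FiniteDimensional F W₂]
    {Q₁ : QuadraticForm F W₁} {Q₂ : QuadraticForm F W₂} (hQ : Nondeg (Q₁.prod Q₂))
    (hu : ∀ c, ∃ u, Q₁ u = c) {n : ℕ} (h : Module.finrank F (W₁ × W₂) = 2 * n + 1)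
    {g : W₂ ≃ₗ[F] W₂} (hg : g ∈ GO Q₂) :
    orderOf g ∣ Monoid.exponent (Omega (oddForm F n)) := by
  have hG : (LinearEquiv.refl F W₁).prodCongr g ∈ GO (Q₁.prod Q₂) := by
    rintro ⟨a, b⟩
    have := hg b
    simp [this]
  obtain ⟨l, hl⟩ := hQ.exists_reflProd h hG
  have hl2 : ∀ x, reflProd (Q₁.prod Q₂) l (0, x) = (0, g x) := fun x => by
    rw [hl]
    rfl
  obtain ⟨l', hl', he, hs⟩ : ∃ l', (∀ x, reflProd (Q₁.prod Q₂) l' (0, x) = (0, g x)) ∧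
      Even l'.length ∧ IsSquare (spinorProd (Q₁.prod Q₂) l') := by
    -- Reflections in vectors of the first summand are trivial on the second. The one in `u` makes
    -- the spinor norm a square; the one in `v`, of norm 1, is added when the parity needs it.
    obtain ⟨u, hu1⟩ := hu (spinorProd (Q₁.prod Q₂) l)
    obtain ⟨v, hv1⟩ := hu 1
    have hu2 : Q₁.prod Q₂ (u, 0) = spinorProd (Q₁.prod Q₂) l := by simp [hu1]
    have hv2 : Q₁.prod Q₂ (v, 0) = 1 := by simp [hv1]
    have hu0 : Q₁.prod Q₂ (u, 0) ≠ 0 := by rw [hu2]; exact spinorProd_ne_zero _ _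
    have hv0 : Q₁.prod Q₂ (v, 0) ≠ 0 := by rw [hv2]; exact one_ne_zero
    rcases Nat.even_or_odd l.length with he | ho
    · refine ⟨l ++ [⟨(u, 0), hu0⟩, ⟨(v, 0), hv0⟩], fun x => ?_, ?_, ?_⟩
      · rw [reflProd_append, reflProd_cons, reflProd_cons, LinearEquiv.mul_apply,
          LinearEquiv.mul_apply, LinearEquiv.mul_apply]
        change reflProd (Q₁.prod Q₂) l (refl _ _ (refl _ _ (0, x))) = _
        rw [refl_inl_mul, refl_inl_mul, hl2]
      · rw [List.length_append]
        exact he.add (by simp)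
      · rw [spinorProd_append]
        refine ⟨spinorProd (Q₁.prod Q₂) l, ?_⟩
        congr 1
        simp only [spinorProd, List.map_cons, List.map_nil, List.prod_cons, List.prod_nil,
          mul_one, hv2]
        rw [hu2, spinorProd]
    · refine ⟨l ++ [⟨(u, 0), hu0⟩], fun x => ?_, ?_, ?_⟩
      · rw [reflProd_append, reflProd_cons, LinearEquiv.mul_apply,
          LinearEquiv.mul_apply]
        change reflProd (Q₁.prod Q₂) l (refl _ _ (0, x)) = _
        rw [refl_inl_mul, hl2]
      · rw [List.length_append]
        exact ho.add_odd (by simp)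
      · rw [spinorProd_append]
        refine ⟨spinorProd (Q₁.prod Q₂) l, ?_⟩
        congr 1
        simp only [spinorProd, List.map_cons, List.map_nil, List.prod_cons, List.prod_nil,
          mul_one]
        rw [hu2, spinorProd]
  refine dvd_trans ?_ (dvd_exponent_of_mem_Omega hQ h ⟨l', he, hs, rfl⟩)
  have hpow : ∀ k x, (reflProd (Q₁.prod Q₂) l' ^ k) (0, x) = (0, (g ^ k) x) := by
    intro k
    induction k with
    | zero => intro x; rfl
    | succ k ih => intro x; rw [pow_succ, LinearEquiv.mul_apply, hl', ih, pow_succ]; rfl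
  rw [orderOf_dvd_iff_pow_eq_one]
  ext x
  have := hpow (orderOf (reflProd (Q₁.prod Q₂) l')) x
  rw [pow_orderOf_eq_one] at this
  exact (congrArg Prod.snd this).symm

theorem dvd_exponent_of_prod [FiniteDimensional F W₂] {Q₂ : QuadraticForm F W₂}
    (hQ : Regular Q₂) {k n : ℕ} (h : Module.finrank F W₂ = 2 * k) (hk : k ≤ n)
    {g : W₂ ≃ₗ[F] W₂} (hg : g ∈ GO Q₂) (hodd : (Odd (orderOf g) ∨ (2 : F) = 0) ∨ k < n) :
    orderOf g ∣ Monoid.exponent (Omega (oddForm F n)) := by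
  have hrank : Module.finrank F ((F × ((Fin (n - k) → F) × (Fin (n - k) → F))) × W₂) =
      2 * n + 1 := by
    simp [h]
    omega
  have hN : Nondeg ((oddForm F (n - k)).prod Q₂) := (nondeg_oddForm (n - k)).prod hQ
  rcases hodd with hodd | hlt
  · rw [← orderOf_prodCongr_refl (W₁ := F × ((Fin (n - k) → F) × (Fin (n - k) → F)))] at hodd ⊢
    refine dvd_exponent_of_mem_GO hN hrank ?_ hodd
    rintro ⟨a, b⟩
    have := hg b
    simp [this]
  · have hu : ∀ c, ∃ u, oddForm F (n - k) u = c := oddForm_universal (by omega)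
    exact dvd_exponent_of_universal hN hu hrank hg

variable (F) in
theorem exists_extension (k : ℕ) (hk : 0 < k) : ∃ (K : Type) (_ : Field K) (_ : Algebra F K),
    Finite K ∧ Module.finrank F K = k ∧ Nat.card K = Nat.card F ^ k := by
  obtain ⟨p, hp⟩ := CharP.exists F
  have hp' : Fact p.Prime := ⟨CharP.char_is_prime F p⟩
  have : NeZero k := ⟨hk.ne'⟩
  exact ⟨FiniteField.Extension F p k, inferInstance, inferInstance, inferInstance,
    FiniteField.finrank_extension F p k, FiniteField.natCard_extension F p k⟩

theorem exists_orderOf_eq {K : Type*} [Field K] [Finite K] {d : ℕ} (hd : d ∣ Nat.card K - 1) :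
    ∃ ζ : Kˣ, orderOf ζ = d := by
  obtain ⟨g, hg⟩ := IsCyclic.exists_ofOrder_eq_natCard (α := Kˣ)
  rw [Nat.card_units] at hg
  obtain ⟨c, hc⟩ := hd
  have h0 : Nat.card K - 1 ≠ 0 := by
    have := Finite.one_lt_card (α := K)
    omega
  have hc0 : c ≠ 0 := fun h => h0 (by rw [hc, h, mul_zero])
  refine ⟨g ^ c, ?_⟩
  rw [orderOf_pow_of_dvd hc0 (by rw [hg, hc]; exact dvd_mul_left _ _), hg, hc,
    Nat.mul_div_cancel _ (Nat.pos_of_ne_zero hc0)]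

/-- Split torus: the units of the extension `K` of degree `k` act on the hyperbolic space `K* × K`.
For `k < n` the complement has dimension at least 3 and is universal, so even orders are also
available. -/
theorem dvd_exponent_of_dvd_sub_one {k n d : ℕ} (hk : 0 < k) (hkn : k ≤ n)
    (hd : d ∣ Nat.card F ^ k - 1) (hodd : (Odd d ∨ (2 : F) = 0) ∨ k < n) :
    d ∣ Monoid.exponent (Omega (oddForm F n)) := by
  obtain ⟨K, _, _, _, hrank, hcard⟩ := exists_extension F k hk
  have : FiniteDimensional F K := FiniteDimensional.of_finrank_pos (by omega)
  rw [← hcard] at hd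
  obtain ⟨ζ, hζ⟩ := exists_orderOf_eq hd
  let ψ : (K ≃ₗ[F] K) →* ((Module.Dual F K × K) ≃ₗ[F] (Module.Dual F K × K)) :=
    { toFun := fun f => (QuadraticForm.dualProdIsometry f).toLinearEquiv
      map_one' := rfl
      map_mul' := fun _ _ => rfl }
  have hψ : Function.Injective ψ := by
    intro f g h
    ext x
    exact congrArg Prod.snd (LinearEquiv.congr_fun h (0, x))
  have ho : orderOf (ψ (mulUnit F ζ)) = d := by
    rw [orderOf_injective ψ hψ, orderOf_injective _ mulUnit_injective, hζ]
  rw [← ho] at hodd ⊢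
  refine dvd_exponent_of_prod regular_dualProd ?_ hkn ?_ hodd
  · rw [Module.finrank_prod, Subspace.dual_finrank_eq, hrank]
    ring
  · exact (QuadraticForm.dualProdIsometry (mulUnit F ζ)).map_app

/-- Nonsplit torus: on the extension `K` of degree `2k`, with `σ` the involution `x ↦ x ^ q ^ k`,
elements with `ζ * σ ζ = 1` preserve the form `Tr (c * x * σ x)`. -/
theorem dvd_exponent_of_dvd_add_one {k n d : ℕ} (hk : 0 < k) (hkn : k ≤ n)
    (hd : d ∣ Nat.card F ^ k + 1) (hodd : Odd d) :
    d ∣ Monoid.exponent (Omega (oddForm F n)) := by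
  have := Fintype.ofFinite F
  obtain ⟨K, _, _, _, hrank, hcard⟩ := exists_extension F (2 * k) (by omega)
  have : FiniteDimensional F K := FiniteDimensional.of_finrank_pos (by omega)
  have := Fintype.ofFinite K
  have hq1 : 1 < Nat.card F := Finite.one_lt_card
  have hd' : d ∣ Nat.card K - 1 := by
    rw [hcard, mul_comm, pow_mul, ← one_pow 2, Nat.sq_sub_sq]
    exact hd.mul_right _
  obtain ⟨ζ, hζ⟩ := exists_orderOf_eq hd'
  let σ : K ≃ₐ[F] K := FiniteField.frobeniusAlgEquivOfAlgebraic F K ^ k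
  have hσ : ∀ x, σ x = x ^ (Nat.card F ^ k) := by
    intro x
    have := congrFun (FiniteField.coe_frobeniusAlgEquivOfAlgebraic_iterate F K k) x
    rw [Nat.card_eq_fintype_card, ← this, ← AlgEquiv.coe_pow]
  have hσσ : ∀ x, σ (σ x) = x := by
    intro x
    rw [hσ, hσ, ← pow_mul, ← pow_add, ← two_mul, ← hcard, Nat.card_eq_fintype_card,
      FiniteField.pow_card]
  -- The factor `c + σ c` appears in the polar form and must not vanish; `c = 1` fails in
  -- characteristic two. A suitable `c` exists because `X ^ q ^ k + X` has degree below `q ^ (2k)`,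
  -- the size of `K`.
  obtain ⟨c, hc⟩ : ∃ c, c + σ c ≠ 0 := by
    by_contra! hcon
    let f : Polynomial K := Polynomial.X ^ (Nat.card F ^ k) + Polynomial.X
    have hk1 : 1 < Nat.card F ^ k := Nat.one_lt_pow hk.ne' hq1
    have hdeg : f.natDegree = Nat.card F ^ k := by
      refine Polynomial.natDegree_add_eq_left_of_natDegree_lt ?_ |>.trans
        (Polynomial.natDegree_X_pow _)
      rwa [Polynomial.natDegree_X_pow, Polynomial.natDegree_X]
    have hf0 : f = 0 := by
      refine Polynomial.eq_zero_of_natDegree_lt_card_of_eval_eq_zero f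
        (f := id) Function.injective_id (fun x => ?_) ?_
      · have := hcon x
        rw [hσ, add_comm] at this
        simpa [f] using this
      · rw [hdeg, ← Nat.card_eq_fintype_card, hcard]
        exact Nat.pow_lt_pow_right hq1 (by omega)
    rw [hf0, Polynomial.natDegree_zero] at hdeg
    omega
  let B : LinearMap.BilinForm F K :=
    (Algebra.traceForm F K).compl₁₂ (LinearMap.mulLeft F c) σ.toLinearMap
  let Q : QuadraticForm F K := LinearMap.BilinMap.toQuadraticMap B
  have hQ : ∀ x, Q x = Algebra.trace F K (c * x * σ x) := fun x => rfl
  have hpol : ∀ x y, polar Q x y = Algebra.trace F K ((c + σ c) * σ x * y) := by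
    intro x y
    have h1 : Algebra.trace F K (c * x * σ y) = Algebra.trace F K (σ c * σ x * y) := by
      rw [← Algebra.trace_eq_of_algEquiv σ (c * x * σ y), map_mul σ, map_mul σ, hσσ]
    rw [polar, hQ, hQ, hQ, ← map_sub, ← map_sub]
    have h2 : c * (x + y) * σ (x + y) - c * x * σ x - c * y * σ y =
        c * x * σ y + c * σ x * y := by
      rw [map_add]
      ring
    rw [h2, map_add, h1, ← map_add]
    congr 1
    ring
  have hreg : Regular Q := by
    intro x hx
    have h1 : (c + σ c) * σ x = 0 := by
      refine (traceForm_nondegenerate F K).1 _ fun y => ?_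
      rw [Algebra.traceForm_apply, ← hpol, hx]
    have h2 := (mul_eq_zero.1 h1).resolve_left hc
    exact (map_eq_zero_iff σ σ.injective).1 h2
  have ho : orderOf (mulUnit F ζ) = d := by
    rw [orderOf_injective _ mulUnit_injective, hζ]
  rw [← ho] at hodd ⊢
  refine dvd_exponent_of_prod hreg hrank hkn ?_ (Or.inl (Or.inl hodd))
  intro x
  rw [hQ, hQ, mulUnit_apply, map_mul σ]
  have hn : (ζ : K) * σ ζ = 1 := by
    rw [hσ, ← pow_succ', ← Units.val_pow_eq_pow_val,
      orderOf_dvd_iff_pow_eq_one.1 (hζ.symm ▸ hd), Units.val_one]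
  refine congrArg _ ?_
  linear_combination (c * x * σ x) * hn

end Orders

-- A long unipotent element in odd dimension.

section Unipotent

variable {F : Type*} [Field F]

/-- The algebra is `F[t] / (t ^ n)` and `l` reads off the top coefficient. -/
theorem exists_truncated.{u} (F : Type u) [Field F] (n : ℕ) (hn : 0 < n) : ∃ (E : Type u) (_ : CommRing E) (_ : Algebra F E)
    (t : E) (l : Module.Dual F E), FiniteDimensional F E ∧ Module.finrank F E = n ∧ t ^ n = 0 ∧
      (∀ k < n - 1, l (t ^ k) = 0) ∧ l (t ^ (n - 1)) = 1 := by
  have hm : (Polynomial.X ^ n : Polynomial F).Monic := Polynomial.monic_X_pow n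
  let pb := AdjoinRoot.powerBasis' hm
  have hdim : pb.dim = n := by
    simp [pb, AdjoinRoot.powerBasis']
  have hpow : ∀ k (hk : k < pb.dim), pb.basis ⟨k, hk⟩ = pb.gen ^ k := fun k hk => by
    rw [pb.basis_eq_pow]
  refine ⟨AdjoinRoot (Polynomial.X ^ n : Polynomial F), 
    (inferInstance : CommRing (AdjoinRoot (Polynomial.X ^ n : Polynomial F))),
    (inferInstance : Algebra F (AdjoinRoot (Polynomial.X ^ n : Polynomial F))), pb.gen,
    pb.basis.coord ⟨n - 1, by omega⟩, pb.finite, by rw [pb.finrank, hdim], ?_, ?_, ?_⟩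
  · have : Polynomial.aeval (AdjoinRoot.root (Polynomial.X ^ n : Polynomial F))
        (Polynomial.X ^ n : Polynomial F) = 0 := by
      rw [AdjoinRoot.aeval_eq, AdjoinRoot.mk_self]
    rwa [map_pow, Polynomial.aeval_X] at this
  · intro k hk
    rw [← hpow k (by omega), Module.Basis.coord_apply, Module.Basis.repr_self,
      Finsupp.single_eq_of_ne]
    intro h
    have := congrArg Fin.val h
    simp only at this
    omega
  · rw [← hpow (n - 1) (by omega), Module.Basis.coord_apply, Module.Basis.repr_self,
      Finsupp.single_eq_same]

variable {E : Type*} [CommRing E] [Algebra F E]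

/-- A unipotent isometry of the form `z ^ 2 + f x` on `F × (Dual F E × E)`, attached to
mutually inverse elements `s` and `r` of the algebra `E`. -/
def unip (F : Type*) [Field F] {E : Type*} [CommRing E] [Algebra F E] (s r : E) :
    F × (Module.Dual F E × E) →ₗ[F] F × (Module.Dual F E × E) where
  toFun w := (w.1 + w.2.1 1, (w.2.1 ∘ₗ LinearMap.mulLeft F s,
    r * (w.2.2 - (2 * w.1 + w.2.1 1) • 1)))
  map_add' v w := by
    refine Prod.ext ?_ (Prod.ext ?_ ?_)
    · simp
      ring
    · ext x
      simp
    · simp only [Prod.snd_add, Prod.fst_add, LinearMap.add_apply, Algebra.smul_def, map_add,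
        map_mul]
      ring
  map_smul' c w := by
    refine Prod.ext ?_ (Prod.ext ?_ ?_)
    · simp
      ring
    · ext x
      simp
    · simp only [Prod.smul_snd, Prod.smul_fst, LinearMap.smul_apply, Algebra.smul_def, map_add,
        map_mul, Algebra.algebraMap_self, RingHom.id_apply]
      ring

theorem unip_sub_one_apply {s r t : E} (hs : s = 1 + t) (hr : s * r = 1)
    (w : F × (Module.Dual F E × E)) :
    (unip F s r - 1) w = (w.2.1 1, (w.2.1 ∘ₗ LinearMap.mulLeft F t,
      -(r * (t * w.2.2 + (2 * w.1 + w.2.1 1) • 1)))) := by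
  refine Prod.ext ?_ (Prod.ext ?_ ?_)
  · simp [unip]
  · ext x
    simp [unip, hs, add_mul]
  · simp only [unip, LinearMap.sub_apply, Module.End.one_apply, LinearMap.coe_mk, AddHom.coe_mk,
      Prod.snd_sub]
    rw [hs] at hr
    linear_combination w.2.2 * hr

theorem unip_isometry {s r : E} (hr : s * r = 1) (w : F × (Module.Dual F E × E)) :
    (QuadraticMap.sq.prod (QuadraticForm.dualProd F E)) (unip F s r w) =
      (QuadraticMap.sq.prod (QuadraticForm.dualProd F E) : QuadraticForm F _) w := by
  simp only [QuadraticMap.prod_apply, QuadraticMap.sq_apply, QuadraticForm.dualProd_apply, unip,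
    LinearMap.coe_mk, AddHom.coe_mk, LinearMap.comp_apply, LinearMap.mulLeft_apply]
  rw [← mul_assoc, hr, one_mul, map_sub, map_smul, smul_eq_mul]
  ring

theorem unip_sub_one_pow_of_zero {s r t : E} (hs : s = 1 + t) (hr : s * r = 1) (k : ℕ) (x : E) :
    ((unip F s r - 1) ^ k) (0, (0, x)) = (0, (0, (-(r * t)) ^ k * x)) := by
  induction k with
  | zero => simp
  | succ k ih =>
    rw [pow_succ', Module.End.mul_apply, ih, unip_sub_one_apply hs hr]
    simp
    ring

theorem unip_sub_one_pow_snd {s r t : E} (hs : s = 1 + t) (hr : s * r = 1) (k : ℕ)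
    (w : F × (Module.Dual F E × E)) :
    (((unip F s r - 1) ^ k) w).2.1 = w.2.1 ∘ₗ LinearMap.mulLeft F (t ^ k) := by
  induction k with
  | zero => ext; simp
  | succ k ih =>
    rw [pow_succ', Module.End.mul_apply, unip_sub_one_apply hs hr]
    simp only [ih]
    ext x
    simp [pow_succ]

theorem unip_sub_one_pow_eq_zero {s r t : E} (hs : s = 1 + t) (hr : s * r = 1) {n : ℕ}
    (ht : t ^ n = 0) : (unip F s r - 1) ^ (2 * n + 1) = 0 := by
  apply LinearMap.ext
  intro w
  have h1 : (((unip F s r - 1) ^ n) w).2.1 = 0 := by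
    rw [unip_sub_one_pow_snd hs hr, ht]
    ext
    simp
  have h2 : ((unip F s r - 1) ^ (1 + n)) w =
      (0, (0, ((unip F s r - 1) (((unip F s r - 1) ^ n) w)).2.2)) := by
    rw [pow_add, pow_one, Module.End.mul_apply]
    refine Prod.ext ?_ (Prod.ext ?_ rfl)
    · rw [unip_sub_one_apply hs hr, h1]
      rfl
    · rw [unip_sub_one_apply hs hr, h1]
      ext
      simp
  rw [show 2 * n + 1 = n + (1 + n) by ring, pow_add, Module.End.mul_apply, h2,
    unip_sub_one_pow_of_zero hs hr, neg_pow, mul_pow, ht]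
  simp

/-- The vector `l` is followed down a chain: `n` steps through the dual of `E` to the coordinate `z
= 1`, one step to a unit multiple of `2 + t` in `E`, then `n - 2` multiplications by `t` up to
units. The total is `2n - 1`, where the result is nonzero in every characteristic. -/
theorem unip_sub_one_pow_ne_zero {s r t : E} (hs : s = 1 + t) (hr : s * r = 1) {n : ℕ}
    (hn : 2 ≤ n) (ht : t ^ n = 0) {l : Module.Dual F E} (hl : ∀ k < n - 1, l (t ^ k) = 0)
    (hl1 : l (t ^ (n - 1)) = 1) : (unip F s r - 1) ^ (2 * n - 1) ≠ 0 := by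
  have ht0 : t ^ (n - 1) ≠ 0 := fun h => by
    rw [h, map_zero] at hl1
    exact zero_ne_one hl1
  have h1 : ∀ k ≤ n - 1, ((unip F s r - 1) ^ k) (0, (l, 0)) =
      (0, (l ∘ₗ LinearMap.mulLeft F (t ^ k), 0)) := by
    intro k
    induction k with
    | zero =>
      intro _
      refine Prod.ext rfl (Prod.ext ?_ rfl)
      ext
      simp
    | succ k ih =>
      intro hk
      rw [pow_succ', Module.End.mul_apply, ih (by omega), unip_sub_one_apply hs hr]
      have := hl k (by omega)
      refine Prod.ext ?_ (Prod.ext ?_ ?_)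
      · simpa using this
      · ext
        simp [pow_succ]
      · simp [this]
  have h2 : ((unip F s r - 1) ^ n) (0, (l, 0)) = (1, (0, -r)) := by
    obtain ⟨k, rfl⟩ : ∃ k, n = k + 1 := ⟨n - 1, by omega⟩
    rw [pow_succ', Module.End.mul_apply, h1 k (by omega), unip_sub_one_apply hs hr]
    simp only [Nat.add_sub_cancel] at hl1
    refine Prod.ext ?_ (Prod.ext ?_ ?_)
    · simpa using hl1
    · ext x
      simp [← mul_assoc, ← pow_succ, ht]
    · simp [hl1]
  have h3 : ((unip F s r - 1) ^ (1 + n)) (0, (l, 0)) = (0, (0, -(r * r) * (2 + t))) := by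
    rw [pow_add, pow_one, Module.End.mul_apply, h2, unip_sub_one_apply hs hr]
    refine Prod.ext ?_ (Prod.ext ?_ ?_)
    · simp
    · ext x
      simp
    · have : ((2 * 1 + (0 : Module.Dual F E) 1) • (1 : E) : E) = 2 := by
        rw [Algebra.smul_def, LinearMap.zero_apply, add_zero, mul_one, mul_one]
        exact map_ofNat _ 2
      simp only [this]
      rw [hs] at hr
      linear_combination 2 * r * hr
  intro h0
  have h4 : ((unip F s r - 1) ^ (2 * n - 1)) (0, (l, 0)) =
      (0, (0, (-(r * t)) ^ (n - 2) * (-(r * r) * (2 + t)))) := by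
    rw [show 2 * n - 1 = (n - 2) + (1 + n) by omega, pow_add, Module.End.mul_apply, h3,
      unip_sub_one_pow_of_zero hs hr]
  rw [h0] at h4
  have h5 : (-(r * t)) ^ (n - 2) * (-(r * r) * (2 + t)) = 0 :=
    (congrArg (fun w => w.2.2) h4).symm
  have h6 : t ^ (n - 2) * (2 + t) = 0 := by
    have e : s ^ (n - 2) * (s * s) * ((-1) ^ (n - 2) * (-1)) *
        ((-(r * t)) ^ (n - 2) * (-(r * r) * (2 + t))) = t ^ (n - 2) * (2 + t) := by
      have e1 : s ^ (n - 2) * r ^ (n - 2) = 1 := by rw [← mul_pow, hr, one_pow]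
      have e2 : ((-1 : E) ^ (n - 2)) * (-1) ^ (n - 2) = 1 := by
        rw [← mul_pow]
        simp
      rw [neg_pow (r * t), mul_pow]
      calc _ = (s ^ (n - 2) * r ^ (n - 2)) * ((-1 : E) ^ (n - 2) * (-1) ^ (n - 2)) *
            (s * r) * (s * r) * (t ^ (n - 2) * (2 + t)) := by ring
        _ = _ := by rw [e1, e2, hr]; ring
    rw [← e, h5, mul_zero]
  have h7 : t ^ (n - 2) * t = t ^ (n - 1) := by
    rw [← pow_succ]
    congr 1
    omega
  have h8 : t ^ (n - 1) * t = 0 := by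
    rw [← pow_succ, ← ht]
    congr 1
    omega
  -- In characteristic two the relation `h6` is `t ^ (n - 1) = 0`; otherwise multiplying it by `t`
  -- gives `2 * t ^ (n - 1) = 0`.
  by_cases h2' : (2 : F) = 0
  · have : (2 : E) = 0 := by
      have := congrArg (algebraMap F E) h2'
      rwa [map_ofNat, map_zero] at this
    rw [this, zero_add, h7] at h6
    exact ht0 h6
  · have h9 : (2 : F) • t ^ (n - 1) = 0 := by
      rw [Algebra.smul_def, map_ofNat]
      linear_combination t * h6 - (2 + t) * h7 - h8
    exact ht0 ((smul_eq_zero.1 h9).resolve_left h2')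

/-- In characteristic `p`, `(u - 1) ^ p ^ a = u ^ p ^ a - 1`, so the nilpotency index of `u - 1`
bounds the order of `u` from below. -/
theorem pow_dvd_exponent_of_char [Finite F] {p : ℕ} [hp : Fact p.Prime] [CharP F p] {n b : ℕ}
    (hn : 2 ≤ n) (hb : p ^ b ≤ 2 * n - 1) :
    p ^ (b + 1) ∣ Monoid.exponent (Omega (oddForm F n)) := by
  obtain ⟨E, _, _, t, l, _, hrank, ht, hl, hl1⟩ := exists_truncated F n (by omega)
  have hnil : IsNilpotent t := ⟨n, ht⟩
  obtain ⟨s, hs⟩ := hnil.isUnit_one_add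
  have hr : (s : E) * (↑s⁻¹ : E) = 1 := s.mul_inv
  let Q : QuadraticForm F (F × (Module.Dual F E × E)) :=
    QuadraticMap.sq.prod (QuadraticForm.dualProd F E)
  have hQ : Nondeg Q := nondeg_sq.prod regular_dualProd
  have hiso : ∀ w, Q (unip F (s : E) (↑s⁻¹ : E) w) = 1 * Q w := fun w => by
    rw [one_mul]
    exact unip_isometry hr w
  let u : (F × (Module.Dual F E × E)) ≃ₗ[F] (F × (Module.Dual F E × E)) :=
    LinearEquiv.ofInjectiveEndo (unip F (s : E) (↑s⁻¹ : E))
      (hQ.injective_similitude one_ne_zero hiso)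
  have hu : u ∈ GO Q := fun w => unip_isometry hr w
  have : Nontrivial (F × (Module.Dual F E × E)) := inferInstance
  have hchar : CharP (Module.End F (F × (Module.Dual F E × E))) p :=
    charP_of_injective_algebraMap (algebraMap F _).injective p
  have hpow : ∀ a, (unip F (s : E) (↑s⁻¹ : E) - 1) ^ p ^ a = 0 ↔ u ^ p ^ a = 1 := by
    intro a
    rw [sub_pow_char_pow_of_commute (R := Module.End F (F × (Module.Dual F E × E))) p a
      (Commute.one_right (unip F (s : E) (↑s⁻¹ : E))), one_pow, sub_eq_zero]
    have hcoe : ∀ k, (unip F (s : E) (↑s⁻¹ : E)) ^ k = (u ^ k).toLinearMap := by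
      intro k
      induction k with
      | zero => rfl
      | succ k ih => rw [pow_succ, ih, pow_succ]; rfl
    rw [hcoe]
    exact ⟨fun h => LinearEquiv.toLinearMap_injective h, fun h => by rw [h]; rfl⟩
  have hne : u ^ p ^ b ≠ 1 := by
    rw [Ne, ← hpow]
    intro h
    refine unip_sub_one_pow_ne_zero (F := F) hs hr hn ht hl hl1 ?_
    rw [← Nat.sub_add_cancel hb, pow_add, h, mul_zero]
  have heq : u ^ p ^ (2 * n + 1) = 1 := by
    rw [← hpow]
    have h1 : 2 * n + 1 ≤ p ^ (2 * n + 1) := (Nat.lt_pow_self hp.out.one_lt).le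
    rw [← Nat.sub_add_cancel h1, pow_add, unip_sub_one_pow_eq_zero hs hr ht, mul_zero]
  obtain ⟨c, -, hc⟩ := (Nat.dvd_prime_pow hp.out).1 (orderOf_dvd_of_pow_eq_one heq)
  have hcb : b + 1 ≤ c := by
    by_contra! hlt
    apply hne
    rw [← orderOf_dvd_iff_pow_eq_one, hc]
    exact pow_dvd_pow p (by omega)
  refine (pow_dvd_pow p hcb).trans ?_
  rw [← hc]
  refine dvd_exponent_of_mem_GO hQ ?_ hu ?_
  · simp only [Module.finrank_prod, Module.finrank_self, Subspace.dual_finrank_eq, hrank]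
    ring
  · rcases hp.out.eq_two_or_odd' with h | h
    · right
      subst h
      exact CharTwo.two_eq_zero
    · left
      rw [hc]
      exact h.pow

end Unipotent

-- Eigenvalues of isometries.

section Eigenvalues

variable {F V : Type*} [Field F] [AddCommGroup V] [Module F V]
  {Q : QuadraticForm F V}

/-- The eigenvalues of a linear map in the algebraic closure. -/
def eigs (g : V ≃ₗ[F] V) : Set (AlgebraicClosure F) :=
  (minpoly F g.toLinearMap).rootSet (AlgebraicClosure F)

theorem finite_eigs (g : V ≃ₗ[F] V) : (eigs g).Finite := Polynomial.rootSet_finite _ _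

theorem coe_pow_equiv (g : V ≃ₗ[F] V) (k : ℕ) : (g ^ k).toLinearMap = g.toLinearMap ^ k := by
  induction k with
  | zero => rfl
  | succ k ih => rw [pow_succ, pow_succ, ← ih]; rfl

theorem polar_aeval {g : V ≃ₗ[F] V} (hg : g ∈ GO Q) (f : Polynomial F) (x y : V) :
    polar Q (Polynomial.aeval g.toLinearMap f x) y =
      polar Q x (Polynomial.aeval g⁻¹.toLinearMap f y) := by
  induction f using Polynomial.induction_on' with
  | add p q hp hq =>
    rw [map_add, map_add, LinearMap.add_apply, LinearMap.add_apply, polar_add_left,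
      polar_add_right, hp, hq]
  | monomial k a =>
    rw [Polynomial.aeval_monomial, Polynomial.aeval_monomial, ← coe_pow_equiv, ← coe_pow_equiv,
      Module.End.mul_apply, Module.End.mul_apply, Module.algebraMap_end_apply,
      Module.algebraMap_end_apply, polar_smul_left, polar_smul_right]
    congr 1
    have h := polar_GO (pow_mem hg k) x ((g⁻¹ ^ k) y)
    have h1 : (g ^ k) ((g⁻¹ ^ k) y) = y := by
      rw [inv_pow]
      exact (g ^ k).apply_symm_apply y
    rw [h1] at h
    exact h

variable [FiniteDimensional F V]

theorem mem_eigs {g : V ≃ₗ[F] V} {x : AlgebraicClosure F} :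
    x ∈ eigs g ↔ Polynomial.aeval x (minpoly F g.toLinearMap) = 0 := by
  rw [eigs, Polynomial.mem_rootSet]
  exact and_iff_right (minpoly.ne_zero (Algebra.IsIntegral.isIntegral _))

theorem ncard_eigs_le (g : V ≃ₗ[F] V) : (eigs g).ncard ≤ Module.finrank F V := by
  refine (Polynomial.ncard_rootSet_le _ _).trans ?_
  rw [← LinearMap.charpoly_natDegree g.toLinearMap]
  exact Polynomial.natDegree_le_of_dvd (LinearMap.minpoly_dvd_charpoly _)
    (LinearMap.charpoly_monic _).ne_zero

theorem aeval_eig {g : V ≃ₗ[F] V} {x : AlgebraicClosure F} (hx : x ∈ eigs g) {f : Polynomial F}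
    (hf : Polynomial.aeval g.toLinearMap f = 0) : Polynomial.aeval x f = 0 := by
  obtain ⟨h, rfl⟩ := minpoly.dvd F _ hf
  rw [map_mul, mem_eigs.1 hx, zero_mul]

theorem eig_pow_eq_one {g : V ≃ₗ[F] V} {x : AlgebraicClosure F} (hx : x ∈ eigs g) {k : ℕ}
    (h : g ^ k = 1) : x ^ k = 1 := by
  have h1 := aeval_eig hx (f := Polynomial.X ^ k - 1) (by
    rw [map_sub, map_pow, Polynomial.aeval_X, ← coe_pow_equiv, h, map_one]
    exact sub_self _)
  rw [map_sub, map_pow, Polynomial.aeval_X, map_one] at h1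
  exact sub_eq_zero.1 h1

theorem eig_pow_card [Finite F] {g : V ≃ₗ[F] V} {x : AlgebraicClosure F} (hx : x ∈ eigs g) :
    x ^ Nat.card F ∈ eigs g := by
  have := Fintype.ofFinite F
  rw [mem_eigs] at hx ⊢
  have h : x ^ Nat.card F = FiniteField.frobeniusAlgHom F (AlgebraicClosure F) x := by
    rw [FiniteField.coe_frobeniusAlgHom, Nat.card_eq_fintype_card]
  rw [h, Polynomial.aeval_algHom_apply, hx, map_zero]

/-- The adjoint of `f(g)` is `f(g⁻¹)`, so the minimal polynomial of `g` also annihilates `g⁻¹`, and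
its reverse annihilates `g`. -/
theorem eig_inv (hQ : Regular Q) {g : V ≃ₗ[F] V} (hg : g ∈ GO Q) {x : AlgebraicClosure F}
    (hx : x ∈ eigs g) (hx0 : x ≠ 0) : x⁻¹ ∈ eigs g := by
  let f := minpoly F g.toLinearMap
  have hf : Polynomial.aeval g⁻¹.toLinearMap f = 0 := by
    ext y
    apply hQ
    intro z
    rw [polar_comm, ← polar_aeval hg, minpoly.aeval, LinearMap.zero_apply, polar_zero_left]
  have hgi : Invertible g⁻¹.toLinearMap := ⟨g.toLinearMap, by
    ext y; exact g.apply_symm_apply y, by ext y; exact g.symm_apply_apply y⟩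
  have hrev : Polynomial.aeval g.toLinearMap f.reverse = 0 := by
    have h1 : Polynomial.aeval (g.toLinearMap) f.reverse * g⁻¹.toLinearMap ^ f.natDegree =
        Polynomial.aeval g⁻¹.toLinearMap f := by
      have key : ∀ p : Polynomial F, ∀ N, p.natDegree ≤ N →
          Polynomial.aeval g.toLinearMap (p.reflect N) * g⁻¹.toLinearMap ^ N =
            Polynomial.aeval g⁻¹.toLinearMap p := by
        intro p N
        refine Polynomial.induction_with_natDegree_le (fun p =>
          Polynomial.aeval g.toLinearMap (p.reflect N) * g⁻¹.toLinearMap ^ N =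
            Polynomial.aeval g⁻¹.toLinearMap p) N ?_ ?_ ?_ p
        · simp
        · intro k a _ hk
          rw [Polynomial.reflect_C_mul_X_pow, Polynomial.revAt_le hk, map_mul, map_mul, map_pow,
            map_pow, Polynomial.aeval_X, Polynomial.aeval_X, Polynomial.aeval_C,
            Polynomial.aeval_C, mul_assoc]
          congr 1
          rw [← coe_pow_equiv, ← coe_pow_equiv, ← coe_pow_equiv]
          have : g⁻¹ ^ k = g ^ (N - k) * g⁻¹ ^ N := by
            rw [← Nat.sub_add_cancel hk, pow_add g⁻¹, Nat.sub_add_cancel hk, ← mul_assoc,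
              ← Commute.mul_pow (Commute.inv_right (Commute.refl g)), mul_inv_cancel, one_pow,
              one_mul]
          rw [this]
          rfl
        · intro p q _ _ hp hq
          rw [Polynomial.reflect_add, map_add, add_mul, hp, hq, map_add]
      exact key f _ le_rfl
    rw [hf] at h1
    have hu : IsUnit (g⁻¹.toLinearMap ^ f.natDegree) := (isUnit_of_invertible _).pow _
    exact (hu.mul_left_eq_zero).1 h1
  have h2 := aeval_eig hx hrev
  rw [mem_eigs]
  have h4 : Polynomial.eval₂ (algebraMap F (AlgebraicClosure F)) x f.reverse = 0 := h2
  have hinv : Invertible x⁻¹ := invertibleOfNonzero (inv_ne_zero hx0)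
  have h5 := Polynomial.eval₂_reverse_mul_pow (algebraMap F (AlgebraicClosure F)) x⁻¹ f
  rw [invOf_eq_inv, inv_inv, h4, zero_mul] at h5
  exact h5.symm

/-- As `X ^ M - 1` is separable, the minimal polynomial has simple roots; it therefore divides `X ^
s - ε` as soon as all its roots satisfy that equation. -/
theorem pow_eq_smul_of_eigs {g : V ≃ₗ[F] V} {M : ℕ} (hM : (M : F) ≠ 0) (hgM : g ^ M = 1) {s : ℕ}
    {ε : F} (h : ∀ x ∈ eigs g, x ^ s = algebraMap F _ ε) (hs : s ≠ 0) (v : V) :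
    (g ^ s) v = ε • v := by
  have hsep : (minpoly F g.toLinearMap).Separable := by
    refine (Polynomial.separable_X_pow_sub_C (1 : F) hM one_ne_zero).of_dvd (minpoly.dvd F _ ?_)
    rw [map_sub, map_pow, Polynomial.aeval_X, ← coe_pow_equiv, hgM, map_one, map_one]
    exact sub_self _
  have hdvd : minpoly F g.toLinearMap ∣ Polynomial.X ^ s - Polynomial.C ε := by
    rw [← Polynomial.map_dvd_map' (algebraMap F (AlgebraicClosure F))]
    have hsp := IsAlgClosed.splits ((minpoly F g.toLinearMap).map
      (algebraMap F (AlgebraicClosure F)))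
    refine hsp.dvd_of_roots_le_roots ?_ ?_
    · exact (Polynomial.map_ne_zero_iff (algebraMap F _).injective).2
        (minpoly.ne_zero (Algebra.IsIntegral.isIntegral _))
    · refine (Multiset.le_iff_subset (Polynomial.nodup_roots hsep.map)).2 fun x hx => ?_
      have hmon : (Polynomial.X ^ s - Polynomial.C ε).Monic := Polynomial.monic_X_pow_sub_C ε hs
      rw [Polynomial.mem_roots ((hmon.map _).ne_zero), Polynomial.IsRoot.def, Polynomial.eval_map]
      have hx1 : x ∈ eigs g := by
        rw [mem_eigs, Polynomial.aeval_def, ← Polynomial.eval_map]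
        exact Polynomial.isRoot_of_mem_roots hx
      rw [← Polynomial.aeval_def, map_sub, map_pow, Polynomial.aeval_X, Polynomial.aeval_C, h x hx1,
        sub_self]
  have h1 : Polynomial.aeval g.toLinearMap (Polynomial.X ^ s - Polynomial.C ε) = 0 := by
    obtain ⟨q, hq⟩ := hdvd
    rw [hq, map_mul, minpoly.aeval, zero_mul]
  rw [map_sub, map_pow, Polynomial.aeval_X, Polynomial.aeval_C, ← coe_pow_equiv] at h1
  exact sub_eq_zero.1 (LinearMap.congr_fun h1 v)

theorem one_mem_eigs {g : V ≃ₗ[F] V} {v : V} (hv : v ≠ 0) (h : g v = v) : 1 ∈ eigs g := by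
  rw [mem_eigs]
  have h1 : ∀ f : Polynomial F, Polynomial.aeval g.toLinearMap f v = f.eval 1 • v := by
    intro f
    have := Module.End.aeval_apply_of_hasEigenvector (f := g.toLinearMap) (p := f) (μ := 1)
      (x := v) ⟨Module.End.mem_eigenspace_iff.2 (by simpa using h), hv⟩
    exact this
  have h2 := h1 (minpoly F g.toLinearMap)
  rw [minpoly.aeval, LinearMap.zero_apply] at h2
  have h3 := (smul_eq_zero.1 h2.symm).resolve_right hv
  have h4 : (1 : AlgebraicClosure F) = algebraMap F _ 1 := (map_one _).symm
  rw [h4, Polynomial.aeval_algebraMap_apply, Polynomial.coe_aeval_eq_eval, h3, map_zero]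

end Eigenvalues

-- Frobenius orbits in a set closed under inversion.

section Orbits

/-- An orbit of length `d` and its inverse are disjoint, giving `2d ≤ 2m`, or they meet and some `x
^ q ^ k` is `x⁻¹`. In the extremal cases the orbits fill `S`; this is recorded because `d = m` and
`j = m` need separate treatment. -/
theorem frobenius_orbit {K : Type*} [Field K] {q m : ℕ} {S : Set K} (hfin : S.Finite)
    (hcard : S.ncard ≤ 2 * m) (hq : ∀ x ∈ S, x ^ q ∈ S) (hinv : ∀ x ∈ S, x⁻¹ ∈ S) {x : K}
    (hx : x ∈ S) (hx0 : x ≠ 0) {r : ℕ} (hr : 0 < r) (hxr : x ^ q ^ r = x) :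
    ∃ d, 0 < d ∧ x ^ q ^ d = x ∧ (∀ k, x ^ q ^ k = x → d ∣ k) ∧
      ((d ≤ m ∧ (d = m → ∀ y ∈ S, ∃ i, y = x ^ q ^ i ∨ y = x⁻¹ ^ q ^ i)) ∨ x ^ 2 = 1 ∨
        ∃ j, 0 < j ∧ d = 2 * j ∧ j ≤ m ∧ x ^ (q ^ j + 1) = 1 ∧
          (j = m → ∀ y ∈ S, ∃ i, y = x ^ q ^ i)) := by
  classical
  let φ : K → K := fun y => y ^ q
  have hφ : ∀ i y, φ^[i] y = y ^ q ^ i := fun i y => congrFun (pow_iterate q i) y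
  let d := Function.minimalPeriod φ x
  have hper : ∀ k, x ^ q ^ k = x → d ∣ k := fun k hk =>
    Function.IsPeriodicPt.minimalPeriod_dvd (by
      rw [Function.IsPeriodicPt, Function.IsFixedPt, hφ, hk])
  have hd0 : 0 < d := Nat.pos_of_dvd_of_pos (hper r hxr) hr
  have hd : x ^ q ^ d = x := by
    rw [← hφ]
    exact Function.iterate_minimalPeriod
  have hmemS : ∀ y ∈ S, ∀ i, y ^ q ^ i ∈ S := by
    intro y hy i
    induction i with
    | zero => simpa using hy
    | succ i ih =>
      rw [pow_succ, pow_mul]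
      exact hq _ ih
  have hinj : Set.InjOn (fun i => x ^ q ^ i) (Finset.range d) := by
    intro i hi j hj hij
    refine Function.iterate_injOn_Iio_minimalPeriod (f := φ) (x := x) ?_ ?_ ?_
    · simpa using hi
    · simpa using hj
    · simpa only [hφ] using hij
  let O := (Finset.range d).image fun i => x ^ q ^ i
  let O' := O.image fun y => y⁻¹
  have hO : O.card = d := by rw [Finset.card_image_of_injOn hinj, Finset.card_range]
  have hO' : O'.card = d := by rw [Finset.card_image_of_injective _ inv_injective, hO]
  have hOS : ∀ y ∈ O, y ∈ S := by
    intro y hy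
    obtain ⟨i, -, rfl⟩ := Finset.mem_image.1 hy
    exact hmemS x hx i
  have hOS' : ∀ y ∈ O', y ∈ S := by
    intro y hy
    obtain ⟨z, hz, rfl⟩ := Finset.mem_image.1 hy
    exact hinv z (hOS z hz)
  have hcard' : hfin.toFinset.card ≤ 2 * m := by rwa [← Set.ncard_eq_toFinset_card S hfin]
  refine ⟨d, hd0, hd, hper, ?_⟩
  by_cases hdisj : Disjoint O O'
  · left
    have hsub : O ∪ O' ⊆ hfin.toFinset := by
      intro y hy
      rw [Set.Finite.mem_toFinset]
      rcases Finset.mem_union.1 hy with h | h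
      · exact hOS y h
      · exact hOS' y h
    have hc : (O ∪ O').card = d + d := by
      rw [Finset.card_union_of_disjoint hdisj, hO, hO']
    have := Finset.card_le_card hsub
    refine ⟨by omega, fun hdm y hy => ?_⟩
    have heq := Finset.eq_of_subset_of_card_le hsub (by omega)
    have hy' : y ∈ O ∪ O' := by
      rw [heq, Set.Finite.mem_toFinset]
      exact hy
    rcases Finset.mem_union.1 hy' with h | h
    · obtain ⟨i, -, rfl⟩ := Finset.mem_image.1 h
      exact ⟨i, Or.inl rfl⟩
    · obtain ⟨z, hz, rfl⟩ := Finset.mem_image.1 h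
      obtain ⟨i, -, rfl⟩ := Finset.mem_image.1 hz
      exact ⟨i, Or.inr (inv_pow _ _).symm⟩
  · right
    obtain ⟨y, hy, hy'⟩ := Finset.not_disjoint_iff.1 hdisj
    obtain ⟨i, hi, rfl⟩ := Finset.mem_image.1 hy
    obtain ⟨z, hz, hzi⟩ := Finset.mem_image.1 hy'
    obtain ⟨j, hj, rfl⟩ := Finset.mem_image.1 hz
    rw [Finset.mem_range] at hi hj
    obtain ⟨k, hk, hxk⟩ : ∃ k < d, x ^ q ^ k = x⁻¹ := by
      refine ⟨(i + (d - j)) % d, Nat.mod_lt _ hd0, ?_⟩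
      have h1 : x ^ q ^ ((i + (d - j)) % d) = x ^ q ^ (i + (d - j)) := by
        rw [← hφ, ← hφ]
        exact Function.iterate_mod_minimalPeriod_eq
      rw [h1, pow_add, pow_mul, ← hzi, inv_pow, ← pow_mul, ← pow_add, Nat.add_sub_cancel' hj.le,
        hd]
    have h2 : x ^ q ^ (2 * k) = x := by
      rw [two_mul, pow_add, pow_mul, hxk, inv_pow, hxk, inv_inv]
    have h3 := hper _ h2
    -- Since `k < d` and `d ∣ 2 * k`, either `k = 0`, where `x = x⁻¹`, or `d = 2 * k`.
    rcases Nat.eq_zero_or_pos k with h0 | hk0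
    · left
      rw [h0, pow_zero, pow_one] at hxk
      rw [pow_two]
      nth_rewrite 2 [hxk]
      exact mul_inv_cancel₀ hx0
    · right
      have hdk : d = 2 * k := by
        obtain ⟨c, hc⟩ := h3
        have : c < 2 := by
          by_contra! hc2
          have := Nat.mul_le_mul_left d hc2
          omega
        interval_cases c <;> omega
      have hsub : O ⊆ hfin.toFinset := fun y hy => by
        rw [Set.Finite.mem_toFinset]
        exact hOS y hy
      have := Finset.card_le_card hsub
      refine ⟨k, hk0, hdk, by omega, ?_, fun hkm y hy => ?_⟩
      · rw [pow_succ, hxk, inv_mul_cancel₀ hx0]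
      · have heq := Finset.eq_of_subset_of_card_le hsub (by omega)
        have hy' : y ∈ O := by
          rw [heq, Set.Finite.mem_toFinset]
          exact hy
        obtain ⟨i, -, rfl⟩ := Finset.mem_image.1 hy'
        exact ⟨i, rfl⟩

end Orbits

-- Odd primes different from the characteristic.

section Odd

variable {F : Type*} [Field F] [Finite F]

/-- Fibre over the first component: over 0 every second component is allowed, over a nonzero one a
hyperplane. -/
theorem card_singular_plusForm (m : ℕ) (hm : 0 < m) :
    Nat.card {v // plusForm F m v = 0} =
      Nat.card F ^ m + (Nat.card F ^ m - 1) * Nat.card F ^ (m - 1) := by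
  classical
  have := Fintype.ofFinite F
  have e : {v // plusForm F m v = 0} ≃ Σ x : Fin m → F, {y : Fin m → F // ∑ i, x i * y i = 0} :=
    { toFun := fun v => ⟨v.1.1, v.1.2, by rw [← plusForm_apply F m v.1]; exact v.2⟩
      invFun := fun p => ⟨(p.1, p.2.1), by rw [plusForm_apply]; exact p.2.2⟩
      left_inv := fun _ => rfl
      right_inv := fun _ => rfl }
  have h0 : Nat.card {y : Fin m → F // ∑ i, (0 : Fin m → F) i * y i = 0} = Nat.card F ^ m := by
    have : Nat.card {y : Fin m → F // ∑ i, (0 : Fin m → F) i * y i = 0} = Nat.card (Fin m → F) :=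
      Nat.card_congr (Equiv.subtypeUnivEquiv fun y => by simp)
    rw [this, Nat.card_fun, Nat.card_eq_fintype_card (α := Fin m), Fintype.card_fin]
  have h1 : ∀ x : Fin m → F, x ≠ 0 → Nat.card {y : Fin m → F // ∑ i, x i * y i = 0} =
      Nat.card F ^ (m - 1) := by
    intro x hx
    obtain ⟨i, hi⟩ := Function.ne_iff.1 hx
    let f : Module.Dual F (Fin m → F) := ∑ i, x i • LinearMap.proj i
    have hf : ∀ y, f y = ∑ i, x i * y i := fun y => by simp [f]
    have hfi : f (Pi.single i 1) ≠ 0 := by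
      rw [hf]
      simpa [Pi.single_apply] using hi
    have h2 := finrank_inf_ker ⊤ f (Submodule.mem_top (x := Pi.single i 1)) hfi
    rw [top_inf_eq, finrank_top, Module.finrank_fin_fun] at h2
    have h3 : Nat.card {y : Fin m → F // ∑ i, x i * y i = 0} = Nat.card (LinearMap.ker f) :=
      Nat.card_congr (Equiv.subtypeEquivRight fun y => by rw [LinearMap.mem_ker, hf])
    rw [h3, Module.natCard_eq_pow_finrank (K := F)]
    congr 1
    omega
  rw [Nat.card_congr e, Nat.card_sigma, ← Finset.add_sum_erase _ _ (Finset.mem_univ 0), h0,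
    Finset.sum_congr rfl fun x hx => h1 x (Finset.ne_of_mem_erase hx), Finset.sum_const,
    Finset.card_erase_of_mem (Finset.mem_univ _), Finset.card_univ, Fintype.card_fun,
    Fintype.card_fin, Nat.card_eq_fintype_card, smul_eq_mul]

/-- If the odd prime `r` divides `q ^ m + 1`, then an isometry of `r`-power order of the plus type
space has a nonzero fixed vector, since it permutes the singular vectors. -/
theorem exists_fixed_of_dvd {m r a : ℕ} (hm : 0 < m) [hr : Fact r.Prime] (hr2 : r ≠ 2)
    {g : ((Fin m → F) × (Fin m → F)) ≃ₗ[F] ((Fin m → F) × (Fin m → F))}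
    (hg : g ∈ GO (plusForm F m)) (hga : g ^ r ^ a = 1) (hdvd : r ∣ Nat.card F ^ m + 1) :
    ∃ v ≠ 0, g v = v := by
  classical
  by_contra! hc
  have := Fintype.ofFinite F
  let X := {v // plusForm F m v = 0}
  let f : Function.End X := fun v => ⟨g v.1, by rw [hg v.1]; exact v.2⟩
  have hf : f ^ r ^ a = 1 := by
    have hpow : ∀ k (v : X), ((f ^ k) v).1 = (g ^ k) v.1 := by
      intro k
      induction k with
      | zero => intro v; rfl
      | succ k ih =>
        intro v
        rw [pow_succ, pow_succ]
        exact ih (f v)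
    funext v
    apply Subtype.ext
    rw [hpow, hga]
    rfl
  -- With 0 as the only fixed singular vector, the number of singular vectors is 1 modulo `r`.
  -- Together with `q ^ m = -1` this yields `q ^ (m - 1) = -1`, then `q = 1` and `2 = 0` modulo `r`.
  have hcard := Equiv.Perm.card_fixedPoints_modEq hf
  have h1 : Fintype.card (Function.fixedPoints f) = 1 := by
    rw [Fintype.card_eq_one_iff]
    refine ⟨⟨⟨0, map_zero _⟩, Subtype.ext (map_zero g)⟩, fun ⟨v, hv⟩ => ?_⟩
    apply Subtype.ext
    apply Subtype.ext
    by_contra h0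
    exact hc v.1 h0 (congrArg Subtype.val hv)
  have hX : Fintype.card X = Nat.card F ^ m + (Nat.card F ^ m - 1) * Nat.card F ^ (m - 1) := by
    rw [← Nat.card_eq_fintype_card]
    exact card_singular_plusForm m hm
  rw [h1, hX] at hcard
  set q := Nat.card F with hq
  have hq0 : 0 < q := Nat.card_pos
  have hz : ((q : ZMod r) ^ m + 1 = 0) := by
    have := (ZMod.natCast_eq_zero_iff (q ^ m + 1) r).2 hdvd
    exact_mod_cast this
  have hz2 : (q : ZMod r) ^ m + ((q : ZMod r) ^ m - 1) * (q : ZMod r) ^ (m - 1) = 1 := by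
    have := (ZMod.natCast_eq_natCast_iff _ _ r).2 hcard
    rw [Nat.cast_add, Nat.cast_mul, Nat.cast_sub (Nat.one_le_pow _ _ hq0)] at this
    exact_mod_cast this
  have h2 : (2 : ZMod r) ≠ 0 := by
    intro h
    have h' : ((2 : ℕ) : ZMod r) = 0 := by exact_mod_cast h
    rw [ZMod.natCast_eq_zero_iff] at h'
    exact hr2 ((Nat.prime_dvd_prime_iff_eq hr.out Nat.prime_two).1 h')
  have hz3 : (q : ZMod r) ^ (m - 1) = -1 := by
    apply mul_left_cancel₀ h2
    linear_combination -hz2 + (1 + (q : ZMod r) ^ (m - 1)) * hz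
  have hz4 : (q : ZMod r) = 1 := by
    have h5 : (q : ZMod r) ^ m = (q : ZMod r) ^ (m - 1) * q := by
      rw [← pow_succ, Nat.sub_add_cancel hm]
    rw [h5, hz3] at hz
    linear_combination -hz
  rw [hz4, one_pow] at hz
  apply h2
  linear_combination hz

/-- Euler's theorem gives the period `M.totient`. For `M` a power of two it forces every orbit
length to be a power of two. -/
theorem eigs_frobenius_orbit {V : Type*} [AddCommGroup V] [Module F V] [FiniteDimensional F V]
    {Q : QuadraticForm F V} (hQ : Regular Q) {m : ℕ} (hV : Module.finrank F V = 2 * m)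
    {g : V ≃ₗ[F] V} (hg : g ∈ GO Q) {M : ℕ} (hM : (M : F) ≠ 0) (hgM : g ^ M = 1)
    {x : AlgebraicClosure F} (hx : x ∈ eigs g) :
    x ≠ 0 ∧ x ^ Nat.card F ^ M.totient = x ∧
    ∃ d, 0 < d ∧ x ^ Nat.card F ^ d = x ∧ (∀ k, x ^ Nat.card F ^ k = x → d ∣ k) ∧
      ((d ≤ m ∧ (d = m → ∀ y ∈ eigs g, ∃ i, y = x ^ Nat.card F ^ i ∨
        y = x⁻¹ ^ Nat.card F ^ i)) ∨ x ^ 2 = 1 ∨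
        ∃ j, 0 < j ∧ d = 2 * j ∧ j ≤ m ∧ x ^ (Nat.card F ^ j + 1) = 1 ∧
          (j = m → ∀ y ∈ eigs g, ∃ i, y = x ^ Nat.card F ^ i)) := by
  have hM0 : M ≠ 0 := fun h => hM (by rw [h, Nat.cast_zero])
  have hne : ∀ y ∈ eigs g, y ≠ 0 := by
    intro y hy h0
    have := eig_pow_eq_one hy hgM
    rw [h0, zero_pow hM0] at this
    exact zero_ne_one this
  have hcop : Nat.Coprime (Nat.card F) M := by
    obtain ⟨p, hp⟩ := CharP.exists F
    have hp' : Fact p.Prime := ⟨CharP.char_is_prime F p⟩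
    have := Fintype.ofFinite F
    obtain ⟨k, -, hk⟩ := FiniteField.card F p
    rw [Nat.card_eq_fintype_card, hk]
    refine Nat.Coprime.pow_left _ ((Nat.Prime.coprime_iff_not_dvd hp'.out).2 fun h => hM ?_)
    exact (CharP.cast_eq_zero_iff F p M).2 h
  have hper : x ^ Nat.card F ^ M.totient = x := by
    have h1 := Nat.ModEq.pow_totient hcop
    have h2 := pow_eq_pow_mod (Nat.card F ^ M.totient) (eig_pow_eq_one hx hgM)
    have h3 := pow_eq_pow_mod 1 (eig_pow_eq_one hx hgM)
    rw [h2, h1, ← h3, pow_one]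
  exact ⟨hne x hx, hper, frobenius_orbit (finite_eigs g) (hV ▸ ncard_eigs_le g)
    (fun y hy => eig_pow_card hy) (fun y hy => eig_inv hQ hg hy (hne y hy)) hx (hne x hx)
    (Nat.totient_pos.2 (Nat.pos_of_ne_zero hM0)) hper⟩

theorem dvd_pow_sub_one_of_orderOf {K : Type*} [Field K] {x : K} (hx : x ≠ 0) {q d : ℕ}
    (hq : 0 < q) (h : x ^ q ^ d = x) : x ^ (q ^ d - 1) = 1 := by
  apply mul_right_cancel₀ hx
  rw [← pow_succ, Nat.sub_add_cancel (Nat.one_le_pow _ _ hq), h, one_mul]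

/-- The orders of the isometries of odd prime power order. -/
theorem exists_dvd_of_odd {m r a : ℕ} (hm : 4 ≤ m) (hme : Even m) [hr : Fact r.Prime]
    (hr2 : r ≠ 2) (hrF : (r : F) ≠ 0)
    {g : ((Fin m → F) × (Fin m → F)) ≃ₗ[F] ((Fin m → F) × (Fin m → F))}
    (hg : g ∈ GO (plusForm F m)) (hga : orderOf g = r ^ (a + 1)) :
    ∃ k, 0 < k ∧ k ≤ m - 1 ∧
      (r ^ (a + 1) ∣ Nat.card F ^ k - 1 ∨ r ^ (a + 1) ∣ Nat.card F ^ k + 1) := by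
  have hga1 : g ^ r ^ (a + 1) = 1 := hga ▸ pow_orderOf_eq_one g
  have hM : ((r ^ (a + 1) : ℕ) : F) ≠ 0 := by
    rw [Nat.cast_pow]
    exact pow_ne_zero _ hrF
  have hrk : Module.finrank F ((Fin m → F) × (Fin m → F)) = 2 * m := by
    simp
    ring
  have hq0 : 0 < Nat.card F := Nat.card_pos
  obtain ⟨x, hx, hxa⟩ : ∃ x ∈ eigs g, x ^ r ^ a ≠ 1 := by
    by_contra! hc
    have h1 : g ^ r ^ a = 1 := by
      ext1 v
      rw [pow_eq_smul_of_eigs (ε := 1) hM hga1 (by simpa using hc)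
        (pow_ne_zero _ hr.out.ne_zero), one_smul]
      rfl
    have h2 := orderOf_dvd_of_pow_eq_one h1
    rw [hga, Nat.pow_dvd_pow_iff_le_right hr.out.one_lt] at h2
    omega
  have hxo : orderOf x = r ^ (a + 1) := orderOf_eq_prime_pow hxa (eig_pow_eq_one hx hga1)
  have hrd : r ∣ r ^ (a + 1) := dvd_pow_self r (by omega)
  obtain ⟨hx0, -, d, hd0, hd, -, h⟩ :=
    eigs_frobenius_orbit (regular_plusForm m) hrk hg hM hga1 hx
  have hdvd : r ^ (a + 1) ∣ Nat.card F ^ d - 1 := by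
    rw [← hxo]
    exact orderOf_dvd_of_pow_eq_one (dvd_pow_sub_one_of_orderOf hx0 hq0 hd)
  rcases h with ⟨hdm, -⟩ | h | ⟨j, hj0, -, hjm, hj, hjall⟩
  · rcases hdm.lt_or_eq with hlt | rfl
    · exact ⟨d, hd0, by omega, Or.inl hdvd⟩
    -- As `m = 2k`, `q ^ m - 1 = (q ^ k + 1) * (q ^ k - 1)`. The factors differ by 2, so the odd
    -- prime `r` divides at most one of them.
    · obtain ⟨k, hk⟩ := hme
      refine ⟨k, by omega, by omega, ?_⟩
      have hfac : Nat.card F ^ d - 1 = (Nat.card F ^ k + 1) * (Nat.card F ^ k - 1) := by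
        rw [hk, ← two_mul, mul_comm 2 k, pow_mul, ← one_pow 2, Nat.sq_sub_sq, one_pow]
      rw [hfac] at hdvd
      have hq1 : 1 ≤ Nat.card F ^ k := Nat.one_le_pow _ _ hq0
      by_cases h1 : r ∣ Nat.card F ^ k + 1
      · right
        refine Nat.Coprime.dvd_of_dvd_mul_right (Nat.Coprime.pow_left _
          ((Nat.Prime.coprime_iff_not_dvd hr.out).2 fun h2 => hr2 ?_)) hdvd
        have h3 := Nat.dvd_sub h1 h2
        rw [show Nat.card F ^ k + 1 - (Nat.card F ^ k - 1) = 2 by omega] at h3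
        exact (Nat.prime_dvd_prime_iff_eq hr.out Nat.prime_two).1 h3
      · left
        exact Nat.Coprime.dvd_of_dvd_mul_left (Nat.Coprime.pow_left _
          ((Nat.Prime.coprime_iff_not_dvd hr.out).2 h1)) hdvd
  · exfalso
    have := hrd.trans (hxo ▸ orderOf_dvd_of_pow_eq_one h)
    exact hr2 ((Nat.prime_dvd_prime_iff_eq hr.out Nat.prime_two).1 this)
  · have hdvd' : r ^ (a + 1) ∣ Nat.card F ^ j + 1 := hxo ▸ orderOf_dvd_of_pow_eq_one hj
    rcases hjm.lt_or_eq with hlt | rfl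
    · exact ⟨j, hj0, by omega, Or.inr hdvd'⟩
    · exfalso
      -- A fixed vector makes 1 an eigenvalue, hence a Frobenius conjugate of `x`. Then `r` divides
      -- a power of `q`, contrary to `r ∣ q ^ j + 1`.
      obtain ⟨v, hv0, hv⟩ := exists_fixed_of_dvd hj0 hr2 hg hga1 (hrd.trans hdvd')
      obtain ⟨i, hi⟩ := hjall rfl 1 (one_mem_eigs hv0 hv)
      have h1 : r ∣ Nat.card F ^ i := hrd.trans (hxo ▸ orderOf_dvd_of_pow_eq_one hi.symm)
      have h2 : r ∣ Nat.card F ^ j := dvd_pow (hr.out.dvd_of_dvd_pow h1) hj0.ne'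
      exact hr.out.one_lt.ne' (Nat.dvd_one.1 ((Nat.dvd_add_right h2).1 (hrd.trans hdvd')))

end Odd

-- The prime two in odd characteristic.

section Even

variable {F : Type*} [Field F] [Finite F]

theorem pow_mod_four_eq_one {q k : ℕ} (hq : Odd q) (hk : Even k) : q ^ k % 4 = 1 := by
  obtain ⟨j, rfl⟩ := hk
  obtain ⟨i, rfl⟩ := hq
  rw [← two_mul, pow_mul, Nat.pow_mod]
  have : (2 * i + 1) ^ 2 % 4 = 1 := by
    have : (2 * i + 1) ^ 2 = 4 * (i * i + i) + 1 := by ring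
    omega
  rw [this, one_pow, Nat.one_mod]

/-- `N + 1` is 2 modulo 4, so an element of 2-power order dividing it has order at most 2. -/
theorem sq_eq_one_of_pow {G : Type*} [Monoid G] {y : G} {N b : ℕ} (hN : N % 4 = 1)
    (h : y ^ (N + 1) = 1) (hb : y ^ 2 ^ b = 1) : y ^ 2 = 1 := by
  obtain ⟨i, -, hi⟩ := (Nat.dvd_prime_pow Nat.prime_two).1 (orderOf_dvd_of_pow_eq_one hb)
  have h1 := orderOf_dvd_of_pow_eq_one h
  rw [hi] at h1
  have h2 : i ≤ 1 := by
    by_contra! hlt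
    have h3 : 4 ∣ N + 1 := (pow_dvd_pow 2 hlt).trans h1
    omega
  rw [← orderOf_dvd_iff_pow_eq_one, hi]
  exact pow_dvd_pow 2 h2

/-- The isometries of `2`-power order in odd characteristic. -/
theorem exists_pow_scalar {m a : ℕ} (hm : 4 ≤ m) (hme : Even m) (h2 : (2 : F) ≠ 0)
    {g : ((Fin m → F) × (Fin m → F)) ≃ₗ[F] ((Fin m → F) × (Fin m → F))}
    (hg : g ∈ GO (plusForm F m)) (hga : g ^ 2 ^ (a + 1) = 1) :
    ∃ k, 0 < k ∧ k < m - 1 ∧ ∃ ε : F, ∀ v, (g ^ (Nat.card F ^ k - 1)) v = ε • v := by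
  have hqodd : Odd (Nat.card F) := by
    have := Fintype.ofFinite F
    have h := FiniteField.odd_card_of_char_ne_two (F := F) (fun h => h2 (by
      have := ringChar.Nat.cast_ringChar (R := F)
      rw [h] at this
      exact_mod_cast this))
    rw [Nat.card_eq_fintype_card]
    exact Nat.odd_iff.2 h
  have hM : ((2 ^ (a + 1) : ℕ) : F) ≠ 0 := by
    rw [Nat.cast_pow]
    exact pow_ne_zero _ (by exact_mod_cast h2)
  have hrk : Module.finrank F ((Fin m → F) × (Fin m → F)) = 2 * m := by
    simp
    ring
  have hq1 : 1 < Nat.card F := Finite.one_lt_card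
  have hlog : 0 < Nat.log 2 (m - 1) := Nat.log_pos (by omega) (by omega)
  -- The largest power of two not exceeding `m - 1`. It is even because `m ≥ 4`, and strictly below
  -- the odd number `m - 1`.
  set D := 2 ^ Nat.log 2 (m - 1) with hD
  have hD1 : D ≤ m - 1 := Nat.pow_log_le_self 2 (by omega)
  have h2D : 2 ∣ D := dvd_pow_self 2 hlog.ne'
  have hDpos : 0 < D := by positivity
  have hDm : D < m - 1 := by
    rw [Nat.even_iff] at hme
    omega
  have hqD : Nat.card F ^ D - 1 ≠ 0 := by
    have := Nat.one_lt_pow hDpos.ne' hq1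
    omega
  have heven : 2 ∣ Nat.card F ^ D - 1 := by
    have := pow_mod_four_eq_one hqodd ((even_iff_two_dvd).2 h2D)
    omega
  refine ⟨D, hDpos, hDm, ?_⟩
  by_cases H : ∀ x ∈ eigs g, x ^ (Nat.card F ^ D - 1) = 1
  · exact ⟨1, pow_eq_smul_of_eigs hM hga (by simpa using H) hqD⟩
  push Not at H
  obtain ⟨x, hx, hxD⟩ := H
  obtain ⟨hx0, hper, d, hd0, hd, hdmin, h⟩ :=
    eigs_frobenius_orbit (regular_plusForm m) hrk hg hM hga hx
  have hxa := eig_pow_eq_one hx hga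
  have hdD : ¬ d ∣ D := by
    rintro ⟨c, hc⟩
    apply hxD
    apply dvd_pow_sub_one_of_orderOf hx0 (by omega)
    rw [hc]
    clear hc
    induction c with
    | zero => simp
    | succ c ih => rw [Nat.mul_succ, pow_add, pow_mul, ih, hd]
  have hsq : x ^ 2 ≠ 1 := by
    intro h
    obtain ⟨c, hc⟩ := heven
    rw [hc, pow_mul, h, one_pow] at hxD
    exact hxD rfl
  obtain ⟨c, -, hc⟩ : ∃ c ≤ a, d = 2 ^ c := by
    have := hdmin _ hper
    rw [Nat.totient_prime_pow_succ Nat.prime_two] at this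
    simpa using (Nat.dvd_prime_pow Nat.prime_two).1 (by simpa using this)
  rcases h with ⟨hdm, hall⟩ | h | ⟨j, hj0, hdj, hjm, hj, -⟩
  -- A power of two `d ≤ m` not dividing `D` must be `m = 2 * D`. Then `x ^ (q ^ D - 1)` has order
  -- 2, so equals -1; all eigenvalues are conjugate to `x` or `x⁻¹`, so the power of `g` is the
  -- scalar -1.
  · have hcl : Nat.log 2 (m - 1) < c := by
      by_contra! hle
      exact hdD (hc ▸ pow_dvd_pow 2 hle)
    have hmd : m - 1 < d := by
      refine lt_of_lt_of_le (Nat.lt_pow_succ_log_self (b := 2) (by omega) (m - 1)) ?_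
      rw [hc]
      exact Nat.pow_le_pow_right (by omega) hcl
    have hdm' : d = m := by omega
    have hcD : d = 2 * D := by
      have h1 : 2 * D ∣ d := by
        rw [hD, hc, ← pow_succ']
        exact pow_dvd_pow 2 hcl
      obtain ⟨e, he⟩ := h1
      have h3 : d < 2 * D * 2 := by
        have := Nat.lt_pow_succ_log_self (b := 2) (by omega) (m - 1)
        rw [pow_succ, ← hD] at this
        omega
      have h4 : e < 2 := by
        rw [he] at h3
        exact Nat.lt_of_mul_lt_mul_left h3
      interval_cases e <;> omega
    have hy : (x ^ (Nat.card F ^ D - 1)) ^ 2 = 1 := by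
      refine sq_eq_one_of_pow (N := Nat.card F ^ D) (b := a + 1)
        (pow_mod_four_eq_one hqodd (even_iff_two_dvd.2 h2D)) ?_ ?_
      · rw [← pow_mul, mul_comm]
        have := dvd_pow_sub_one_of_orderOf hx0 (by omega) hd
        rwa [hcD, mul_comm 2 D, pow_mul, ← one_pow 2, Nat.sq_sub_sq] at this
      · rw [← pow_mul, mul_comm, pow_mul, hxa, one_pow]
    have hy1 : x ^ (Nat.card F ^ D - 1) = -1 := (sq_eq_one_iff.1 hy).resolve_left hxD
    refine ⟨-1, pow_eq_smul_of_eigs hM hga (fun z hz => ?_) hqD⟩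
    rw [map_neg, map_one]
    obtain ⟨i, rfl | rfl⟩ := hall hdm' z hz
    · rw [← pow_mul, mul_comm, pow_mul, hy1, (hqodd.pow).neg_one_pow]
    · rw [← pow_mul, mul_comm, pow_mul, inv_pow, hy1, inv_neg, inv_one, (hqodd.pow).neg_one_pow]
  · exact absurd h hsq
  -- Here `d = 2 * j` with `j` a power of two. For `j = 1`, `d = 2` divides `D`; for even `j`, `q ^
  -- j + 1` is 2 modulo 4, which forces `x ^ 2 = 1`.
  · exfalso
    obtain ⟨e, rfl⟩ : ∃ e, c = e + 1 := by
      refine ⟨c - 1, ?_⟩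
      rcases Nat.eq_zero_or_pos c with h0 | h0
      · rw [h0] at hc
        omega
      · omega
    have hje : j = 2 ^ e := by
      rw [pow_succ] at hc
      omega
    rcases Nat.eq_zero_or_pos e with h0 | h0
    · rw [h0] at hc
      rw [hc] at hdD
      exact hdD (by simpa using h2D)
    · refine hsq (sq_eq_one_of_pow (pow_mod_four_eq_one hqodd ?_) hj hxa)
      rw [hje, even_iff_two_dvd]
      exact dvd_pow_self 2 h0.ne'

end Even

-- Unipotent isometries of the even-dimensional space.

section UnipotentBound

variable {F V : Type*} [Field F] [AddCommGroup V] [Module F V] [FiniteDimensional F V]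

/-- The ranges of the powers shrink strictly until they vanish: once two consecutive ones agree, all
later ones do. -/
theorem finrank_range_pow_of_isNilpotent {N : Module.End F V} (hN : IsNilpotent N) (i : ℕ) :
    Module.finrank F (LinearMap.range (N ^ i)) ≤ Module.finrank F V - i := by
  induction i with
  | zero => exact Submodule.finrank_le _
  | succ i ih =>
    have hle : LinearMap.range (N ^ (i + 1)) ≤ LinearMap.range (N ^ i) := by
      rw [pow_succ]
      exact LinearMap.range_comp_le_range N (N ^ i)
    rcases hle.lt_or_eq with hlt | heq
    · have := Submodule.finrank_lt_finrank_of_lt hlt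
      omega
    · have hall : ∀ j, LinearMap.range (N ^ (i + j)) = LinearMap.range (N ^ i) := by
        intro j
        induction j with
        | zero => rfl
        | succ j ihj =>
          rw [← add_assoc, pow_succ', Module.End.mul_eq_comp, LinearMap.range_comp, ihj,
            ← LinearMap.range_comp, ← Module.End.mul_eq_comp, ← pow_succ', heq]
      obtain ⟨k, hk⟩ := hN
      have h0 := hall k
      rw [pow_add, hk, mul_zero, LinearMap.range_zero] at h0
      rw [heq, ← h0, finrank_bot]
      exact Nat.zero_le _

variable {Q : QuadraticForm F V}

/-- In odd characteristic an isometry `h` for which `h - 1` has rank at most one and square zero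
is trivial. -/
theorem eq_one_of_rank_le_one (h2 : (2 : F) ≠ 0) (hQ : Regular Q) {h : V ≃ₗ[F] V} (hg : h ∈ GO Q)
    (hrank : Module.finrank F (LinearMap.range (h.toLinearMap - 1 : Module.End F V)) ≤ 1)
    (hsq : (h.toLinearMap - 1 : Module.End F V) ^ 2 = 0) : h = 1 := by
  set N : Module.End F V := h.toLinearMap - 1 with hN
  have hNx : ∀ x, N x = h x - x := fun x => rfl
  -- Since `N ^ 2 = 0`, the inverse of `h = 1 + N` is `1 - N`, so `N` is skew for the polar form. A
  -- skew map has no rank one in odd characteristic: `polar Q (N x) x = 0` places its image in the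
  -- radical.
  have hadj : ∀ x y, polar Q (N x) y = - polar Q x (N y) := by
    intro x y
    have h1 := polar_GO hg x (y - N y)
    have h3 : h (y - N y) = y := by
      have := LinearMap.congr_fun hsq y
      rw [pow_two, Module.End.mul_apply, LinearMap.zero_apply, hNx (N y)] at this
      rw [map_sub, sub_eq_zero.1 this, hNx]
      abel
    rw [h3, polar_sub_right] at h1
    rw [hNx, polar_sub_left, h1]
    ring
  by_contra hne
  obtain ⟨x₀, hx₀⟩ : ∃ x, N x ≠ 0 := by
    by_contra! hc
    apply hne
    ext1 x
    exact sub_eq_zero.1 (hc x)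
  obtain ⟨v, hv⟩ := finrank_le_one_iff.1 hrank
  apply hx₀
  apply hQ
  intro x
  by_cases hx : N x = 0
  · rw [hadj, hx, polar_zero_right, neg_zero]
  · have h1 : polar Q (N x) x = 0 := by
      have h3 := hadj x x
      rw [polar_comm Q x] at h3
      have : 2 * polar Q (N x) x = 0 := by linear_combination h3
      exact (mul_eq_zero.1 this).resolve_left h2
    obtain ⟨c, hc⟩ := hv ⟨N x, x, rfl⟩
    obtain ⟨c₀, hc₀⟩ := hv ⟨N x₀, x₀, rfl⟩
    have hc' : c • (v : V) = N x := congrArg Subtype.val hc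
    have hc₀' : c₀ • (v : V) = N x₀ := congrArg Subtype.val hc₀
    have hcne : c ≠ 0 := fun h => hx (by rw [← hc', h, zero_smul])
    rw [← hc', polar_smul_left, smul_eq_mul] at h1
    rw [← hc₀', polar_smul_left, smul_eq_mul, (mul_eq_zero.1 h1).resolve_left hcne, mul_zero]

/-- Nilpotency gives `p ^ b < 2m`. The value `2m - 1` would make `g ^ p ^ b - 1` of rank at most one
in odd characteristic, and is odd and too large for `p = 2`. The value `2m - 2` would make the odd
number `m - 1 ≥ 3` a power of two. -/
theorem char_pow_le {p : ℕ} [hp : Fact p.Prime] [CharP F p] {m b : ℕ} (hm : 4 ≤ m)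
    (hme : Even m) (hQ : Regular Q) (hV : Module.finrank F V = 2 * m) {g : V ≃ₗ[F] V}
    (hg : g ∈ GO Q) (hgo : orderOf g = p ^ (b + 1)) : p ^ b ≤ 2 * (m - 1) - 1 := by
  have : Nontrivial V := Module.nontrivial_of_finrank_pos (R := F) (by omega)
  have hchar : CharP (Module.End F V) p :=
    charP_of_injective_algebraMap (algebraMap F _).injective p
  set N : Module.End F V := g.toLinearMap - 1 with hN
  have hpow : ∀ a, N ^ p ^ a = (g ^ p ^ a).toLinearMap - 1 := by
    intro a
    rw [hN, sub_pow_char_pow_of_commute (R := Module.End F V) p a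
      (Commute.one_right g.toLinearMap), one_pow, coe_pow_equiv]
  have hnil : IsNilpotent N := by
    refine ⟨p ^ (b + 1), ?_⟩
    rw [hpow, ← hgo, pow_orderOf_eq_one]
    exact sub_self _
  have hrange := finrank_range_pow_of_isNilpotent hnil
  have hzero : ∀ k, 2 * m ≤ k → N ^ k = 0 := by
    intro k hk
    have := hrange k
    rw [hV, Nat.sub_eq_zero_of_le hk, Nat.le_zero, Submodule.finrank_eq_zero] at this
    exact LinearMap.range_eq_bot.1 this
  have hgb : g ^ p ^ b ≠ 1 := by
    intro h
    have h1 := orderOf_dvd_of_pow_eq_one h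
    rw [hgo, Nat.pow_dvd_pow_iff_le_right hp.out.one_lt] at h1
    omega
  have hNb : N ^ p ^ b ≠ 0 := by
    rw [hpow]
    intro h
    exact hgb (LinearEquiv.toLinearMap_injective (sub_eq_zero.1 h))
  have hlt : p ^ b < 2 * m := by
    by_contra! hle
    exact hNb (hzero _ hle)
  rw [Nat.even_iff] at hme
  have hne1 : p ^ b ≠ 2 * m - 1 := by
    intro heq
    by_cases h2 : (2 : F) = 0
    · have h2p : p ∣ 2 := (CharP.cast_eq_zero_iff F p 2).1 (by exact_mod_cast h2)
      have hp2 : p = 2 := (Nat.prime_dvd_prime_iff_eq hp.out Nat.prime_two).1 h2p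
      rcases Nat.eq_zero_or_pos b with h0 | h0
      · rw [h0, pow_zero] at heq
        omega
      · have : 2 ∣ p ^ b := hp2 ▸ dvd_pow_self _ h0.ne'
        omega
    · refine hgb (eq_one_of_rank_le_one h2 hQ (pow_mem hg _) ?_ ?_)
      · rw [← hpow, heq]
        refine (hrange _).trans ?_
        omega
      · rw [← hpow, ← pow_mul]
        exact hzero _ (by omega)
  have hne2 : p ^ b ≠ 2 * m - 2 := by
    intro heq
    have h2p : p ∣ p ^ b := by
      refine dvd_pow_self p fun h0 => ?_
      rw [h0, pow_zero] at heq
      omega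
    have h2 : 2 ∣ p ^ b := by omega
    have hp2 : 2 = p := (Nat.prime_dvd_prime_iff_eq Nat.prime_two hp.out).1
      (Nat.prime_two.dvd_of_dvd_pow h2)
    have hdvd : m - 1 ∣ 2 ^ b := ⟨2, by rw [hp2, heq, ← hp2]; omega⟩
    obtain ⟨c, -, hc⟩ := (Nat.dvd_prime_pow Nat.prime_two).1 hdvd
    rcases Nat.eq_zero_or_pos c with h0 | h0
    · rw [h0, pow_zero] at hc
      omega
    · have : 2 ∣ m - 1 := hc ▸ dvd_pow_self 2 h0.ne'
      omega
  omega

end UnipotentBound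

-- Comparison of the exponents, prime by prime.

section Exponent

variable {F : Type*} [Field F]

theorem pow_two_eq_one_of_mem_scalars {V : Type*} [AddCommGroup V] [Module F V]
    {Q : QuadraticForm F V} {w : V} (hw : Q w ≠ 0) {g : Omega Q} (hg : g ∈ scalars Q) :
    g ^ 2 = 1 ∧ ((2 : F) = 0 → g = 1) := by
  obtain ⟨c, hc⟩ := hg
  have h1 : c * c = 1 := by
    have := Omega_le_GO Q g.2 w
    rw [hc, QuadraticMap.map_smul, smul_eq_mul] at this
    exact mul_right_cancel₀ hw (this.trans (one_mul _).symm)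
  constructor
  · rw [pow_two]
    apply Subtype.ext
    ext x
    change g.1 (g.1 x) = x
    rw [hc, hc, smul_smul, h1, one_smul]
  · intro h2
    have h3 : c = 1 := by
      have : (c - 1) * (c - 1) = 0 := by linear_combination h1 + (1 - c) * h2
      exact sub_eq_zero.1 (mul_self_eq_zero.1 this)
    apply Subtype.ext
    ext x
    rw [hc, h3, one_smul]
    rfl

theorem exponent_POmega_dvd [Finite F] {m : ℕ} (hm : 4 ≤ m) (hme : Even m)
    {w : (Fin m → F) × (Fin m → F)} (hw : plusForm F m w ≠ 0) :
    Monoid.exponent (POmega (plusForm F m)) ∣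
      Monoid.exponent (Omega (oddForm F (m - 1))) := by
  have hfin : Finite (((Fin m → F) × (Fin m → F)) ≃ₗ[F] ((Fin m → F) × (Fin m → F))) :=
    Finite.of_injective _ DFunLike.coe_injective
  have hrk : Module.finrank F ((Fin m → F) × (Fin m → F)) = 2 * m := by
    simp
    ring
  obtain ⟨p, hp⟩ := CharP.exists F
  have hp' : Fact p.Prime := ⟨CharP.char_is_prime F p⟩
  refine (Nat.dvd_iff_prime_pow_dvd_dvd _ _).2 fun r e hr he => ?_
  have hr' : Fact r.Prime := ⟨hr⟩
  obtain ⟨γ, hγ⟩ := hr.exists_orderOf_eq_pow_factorization_exponent (POmega (plusForm F m))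
  have hexp : Monoid.exponent (POmega (plusForm F m)) ≠ 0 := Monoid.exponent_ne_zero_of_finite
  have hele := (hr.pow_dvd_iff_le_factorization hexp).1 he
  refine (pow_dvd_pow r hele).trans ?_
  rcases Nat.eq_zero_or_pos ((Monoid.exponent (POmega (plusForm F m))).factorization r) with h0 | h0
  · rw [h0, pow_zero]
    exact one_dvd _
  obtain ⟨a, ha⟩ : ∃ a, (Monoid.exponent (POmega (plusForm F m))).factorization r = a + 1 :=
    ⟨_, (Nat.sub_add_cancel h0).symm⟩
  rw [ha] at hγ ⊢
  obtain ⟨g, rfl⟩ := QuotientGroup.mk'_surjective (scalars (plusForm F m)) γ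
  have hgs : g ^ r ^ (a + 1) ∈ scalars (plusForm F m) := by
    rw [← QuotientGroup.eq_one_iff]
    change QuotientGroup.mk' _ (g ^ r ^ (a + 1)) = 1
    rw [map_pow, ← hγ, pow_orderOf_eq_one]
  have hscal := pow_two_eq_one_of_mem_scalars hw hgs
  -- Only here can scalars affect the `r`-part of the order, so the projective order is bounded
  -- directly. Otherwise the scalars have order prime to `r`, and `g` or `g ^ 2` is a lift of order
  -- exactly `r ^ (a + 1)`.
  by_cases hcase : r = 2 ∧ (2 : F) ≠ 0
  · obtain ⟨rfl, h2⟩ := hcase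
    have hg1 : g.1 ^ 2 ^ (a + 1 + 1) = 1 := by
      have := hscal.1
      rw [← pow_mul, ← pow_succ] at this
      exact congrArg Subtype.val this
    obtain ⟨k, hk0, hkm, ε, hε⟩ := exists_pow_scalar hm hme h2 (Omega_le_GO _ g.2) hg1
    have hmem : g ^ (Nat.card F ^ k - 1) ∈ scalars (plusForm F m) := ⟨ε, hε⟩
    refine dvd_exponent_of_dvd_sub_one hk0 hkm.le ?_ (Or.inr hkm)
    rw [← hγ]
    apply orderOf_dvd_of_pow_eq_one
    rw [← map_pow]
    exact (QuotientGroup.eq_one_iff _).2 hmem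
  · obtain ⟨h, hh⟩ : ∃ h : Omega (plusForm F m), orderOf h = r ^ (a + 1) := by
      by_cases hr2 : r = 2
      · have h2 : (2 : F) = 0 := by
          by_contra h2
          exact hcase ⟨hr2, h2⟩
        refine ⟨g, Nat.dvd_antisymm (orderOf_dvd_of_pow_eq_one (hscal.2 h2)) ?_⟩
        rw [← hγ]
        exact orderOf_map_dvd _ g
      · refine ⟨g ^ 2, Nat.dvd_antisymm (orderOf_dvd_of_pow_eq_one ?_) ?_⟩
        · rw [← pow_mul, mul_comm, pow_mul, hscal.1]
        · have hcop : (orderOf (QuotientGroup.mk' (scalars (plusForm F m)) g)).Coprime 2 := by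
            rw [hγ]
            exact Nat.Coprime.pow_left _ ((Nat.coprime_primes hr Nat.prime_two).2 hr2)
          rw [← hγ, ← hcop.orderOf_pow, ← map_pow]
          exact orderOf_map_dvd _ (g ^ 2)
    have hh' : orderOf h.1 = r ^ (a + 1) := by rw [Subgroup.orderOf_coe, hh]
    by_cases hrF : (r : F) = 0
    · have hrp : p = r := (Nat.prime_dvd_prime_iff_eq hp'.out hr).1
        ((CharP.cast_eq_zero_iff F p r).1 hrF)
      subst hrp
      exact pow_dvd_exponent_of_char (by omega)
        (char_pow_le hm hme (regular_plusForm m) hrk (Omega_le_GO _ h.2) hh')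
    · have hr2 : r ≠ 2 := by
        rintro rfl
        exact hcase ⟨rfl, by exact_mod_cast hrF⟩
      have hodd : Odd (r ^ (a + 1)) := (hr.odd_of_ne_two hr2).pow
      obtain ⟨k, hk0, hkm, hk | hk⟩ := exists_dvd_of_odd hm hme hr2 hrF (Omega_le_GO _ h.2) hh'
      · exact dvd_exponent_of_dvd_sub_one hk0 hkm hk (Or.inl (Or.inl hodd))
      · exact dvd_exponent_of_dvd_add_one hk0 hkm hk hodd

end Exponent

end FiniteOrthogonal

end

theorem mainTheorem6 {F : Type*} [Field F] [Finite F] (m : ℕ) (hm : 4 ≤ m) (hm_even : Even m)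
    (w : (Fin m → F) × (Fin m → F)) (hw : FiniteOrthogonal.plusForm F m w ≠ 0) :
    Nonempty (FiniteOrthogonal.stab (FiniteOrthogonal.plusForm F m) w ≃*
        FiniteOrthogonal.Omega (FiniteOrthogonal.oddForm F (m - 1))) ∧
      FiniteOrthogonal.stab (FiniteOrthogonal.plusForm F m) w ≠ ⊤ ∧
      Monoid.exponent (FiniteOrthogonal.stab (FiniteOrthogonal.plusForm F m) w) =
        Monoid.exponent (FiniteOrthogonal.POmega (FiniteOrthogonal.plusForm F m)) := by
  have hrk : Module.finrank F ((Fin m → F) × (Fin m → F)) = 2 * (m - 1) + 2 := by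
    simp
    omega
  have hreg := FiniteOrthogonal.regular_plusForm (F := F) m
  have hiso := FiniteOrthogonal.nonempty_stab_equiv hreg hw hrk
  refine ⟨hiso, FiniteOrthogonal.stab_ne_top hreg hw (by omega), Nat.dvd_antisymm ?_ ?_⟩
  · exact Monoid.exponent_dvd_of_monoidHom _ (Subgroup.subtype_injective _)
  · obtain ⟨e⟩ := hiso
    rw [Monoid.exponent_eq_of_mulEquiv e]
    exact FiniteOrthogonal.exponent_POmega_dvd hm hm_even hw
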